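/- Let $G$ be a compact Lie group, $M$ a smooth $G$-manifold, and $R, S \subset M$ disjoint smooth (embedded, not necessarily closed) submanifolds that are preserved by $G$. Manifolds are finite-dimensional, Hausdorff and second countable, of constant dimension and without boundary. Assume that the pair $(S,R)$ satisfies Whitney's condition (B): for every $y \in R$ there is a smooth chart $c$ of $M$ around $y$ such that, whenever $x_k \in S$ and $z_k \in R$ are sequences in the domain of $c$ converging to $y$ for which the subspaces $dc(T_{x_k}S)$ converge to a subspace $\tau$ of $\mathbb{R}^{\dim M}$ in the Grassmannian and the lines $\mathbb{R}\,(c(x_k)-c(z_k))$ converge to a line $\ell$ in projective space, one has $\ell \subset \tau$. Let $\mathsf{T} = (E,\varepsilon,\varphi)$ be a $G$-equivariant tubular neighbourhood of $R$ in $M$: $\pi_E : E \to R$ is a smooth $G$-vector bundle with a smooth $G$-invariant inner product on its fibres, $\varepsilon : R \to (0,\infty)$ is a $G$-invariant smooth function, and $\varphi$ is a $G$-equivariant diffeomorphism from $B_\varepsilon := \{ v \in E : \langle v,v\rangle < \varepsilon(\pi_E(v))\}$ onto an open neighbourhood $T$ of $R$ in $M$ whose composition with the zero section is the inclusion $R \hookrightarrow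 M$. Put $\pi_T := \pi_E \circ \varphi^{-1} : T \to R$ and $\varrho_T(x) := \langle \varphi^{-1}(x), \varphi^{-1}(x)\rangle$ for $x \in T$, and, for a function $\varepsilon' : R \to (0,\infty)$, put $B_{\varepsilon'} := \{v \in E : \langle v,v\rangle < \varepsilon'(\pi_E(v))\}$ and $T^\circ_{\varepsilon'} := \varphi(B_\varepsilon \cap B_{\varepsilon'})$. Then there exists a $G$-invariant smooth function $\varepsilon' : R \to (0,\infty)$ such that $\varrho_T > 0$ on $S \cap T^\circ_{\varepsilon'}$ and the map $$(\pi_T, \varrho_T) : S \cap T^\circ_{\varepsilon'} \to R \times (0,\infty)$$ is a smooth submersion (that is, it is smooth with surjective differential at every point). -/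

import Mathlib

open Set Filter Topology Manifold Bundle
open scoped ContDiff

noncomputable section

/-- Convergence `V k → W` in the Grassmannian of a finite-dimensional Euclidean space, the
Grassmannian being embedded in the space of operators by sending a subspace to the orthogonal
projection onto it. -/
def SubspaceTendsto {m : ℕ} (V : ℕ → Submodule ℝ (EuclideanSpace ℝ (Fin m)))
    (W : Submodule ℝ (EuclideanSpace ℝ (Fin m))) : Prop :=
  Tendsto (fun k => (V k).starProjection) atTop (𝓝 W.starProjection)

/-- The tangent space at `p` of the embedded submanifold `i : S → M`, read in the chart `c` of `M`:
the subspace `d(c ∘ i)_p (T_p S)` of `ℝ^m`. -/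
def tangentInChart {m s : ℕ} {M S : Type*}
    [TopologicalSpace M] [TopologicalSpace S] [ChartedSpace (EuclideanSpace ℝ (Fin s)) S]
    (i : S → M) (c : OpenPartialHomeomorph M (EuclideanSpace ℝ (Fin m))) (p : S) :
    Submodule ℝ (EuclideanSpace ℝ (Fin m)) :=
  LinearMap.range (mfderiv (𝓡 s) (𝓡 m) (fun q : S => c (i q)) p).toLinearMap

/-- Whitney's condition (B) for the pair `(S, R)` of disjoint submanifolds of `M`, where `S` is given
through its inclusion `i : S → M`: every `y ∈ R` has a smooth chart `c` of `M` around it such that,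
whenever `x k ∈ S` and `z k ∈ R` converge to `y`, the tangent spaces `T_{x k} S` converge to a
subspace `τ` and the secant lines through `x k` and `z k` converge to a line `ℓ` (all read in the
chart), the line `ℓ` is contained in `τ`. -/
def WhitneyConditionB {m s : ℕ} {M S : Type*}
    [TopologicalSpace M] [ChartedSpace (EuclideanSpace ℝ (Fin m)) M]
    [TopologicalSpace S] [ChartedSpace (EuclideanSpace ℝ (Fin s)) S]
    (i : S → M) (R : Set M) : Prop :=
  ∀ y ∈ R, ∃ c ∈ IsManifold.maximalAtlas (𝓡 m) ∞ M, y ∈ c.source ∧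
    ∀ (x : ℕ → S) (z : ℕ → M) (τ ℓ : Submodule ℝ (EuclideanSpace ℝ (Fin m))),
      (∀ k, i (x k) ∈ c.source) → (∀ k, z k ∈ R ∩ c.source) →
      Tendsto (fun k => i (x k)) atTop (𝓝 y) → Tendsto z atTop (𝓝 y) →
      SubspaceTendsto (fun k => tangentInChart (s := s) i c (x k)) τ →
      SubspaceTendsto (fun k => Submodule.span ℝ {c (i (x k)) - c (z k)}) ℓ →
      ℓ ≤ τ

/-- `f` is a smooth submersion on the open set `U`: it is smooth there and its differential is
surjective at every point of `U`. -/
def IsSmoothSubmersionOn {E H E' H' N P : Type*}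
    [NormedAddCommGroup E] [NormedSpace ℝ E] [TopologicalSpace H]
    [NormedAddCommGroup E'] [NormedSpace ℝ E'] [TopologicalSpace H']
    (I : ModelWithCorners ℝ E H) (J : ModelWithCorners ℝ E' H')
    [TopologicalSpace N] [ChartedSpace H N] [TopologicalSpace P] [ChartedSpace H' P]
    (f : N → P) (U : Set N) : Prop :=
  IsOpen U ∧ ContMDiffOn I J ∞ f U ∧ ∀ x ∈ U, Function.Surjective (mfderiv I J f x)

/-- For a smooth vector bundle `V` over a `G`-manifold `R` with an inner product on its fibres and an
action of `G` on its total space: the action makes it a smooth `G`-vector bundle (smooth, covering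
the action on `R`, linear on fibres) and preserves the inner product. -/
structure IsEquivariantRiemannianBundle (d r : ℕ) (G R F : Type*) (V : R → Type*)
    [TopologicalSpace G] [ChartedSpace (EuclideanSpace ℝ (Fin d)) G] [Group G]
    [TopologicalSpace R] [ChartedSpace (EuclideanSpace ℝ (Fin r)) R] [MulAction G R]
    [NormedAddCommGroup F] [NormedSpace ℝ F]
    [∀ x, NormedAddCommGroup (V x)] [∀ x, InnerProductSpace ℝ (V x)]
    [TopologicalSpace (TotalSpace F V)] [FiberBundle F V]
    [MulAction G (TotalSpace F V)] : Prop where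
  contMDiffSMul : ContMDiffSMul (𝓡 d) ((𝓡 r).prod 𝓘(ℝ, F)) ∞ G (TotalSpace F V)
  smul_fiber : ∀ (g : G) (x : R), ∃ L : V x →ₗᵢ[ℝ] V (g • x),
    ∀ v : V x, g • (⟨x, v⟩ : TotalSpace F V) = ⟨g • x, L v⟩

/-- The set `B(ε, V)` of the vectors `v` of the bundle with `⟨v, v⟩ < ε (π v)`. -/
def bundleBall {R F : Type*} {V : R → Type*}
    [∀ x, NormedAddCommGroup (V x)] [∀ x, InnerProductSpace ℝ (V x)] (ε : R → ℝ) :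
    Set (TotalSpace F V) :=
  {v | inner ℝ v.snd v.snd < ε v.proj}

/-- A `G`-equivariant tubular neighbourhood `(V, ε, φ)` of the `G`-invariant submanifold `R` of `M`,
where `V` is a `G`-vector bundle over `R` with invariant inner product (see
`IsEquivariantRiemannianBundle`). The tube itself is `φ.target`. -/
structure EquivariantTubularNeighborhood {m r : ℕ} {G M : Type*} [Group G]
    [TopologicalSpace M] [ChartedSpace (EuclideanSpace ℝ (Fin m)) M] [MulAction G M]
    (R : SubMulAction G M) [ChartedSpace (EuclideanSpace ℝ (Fin r)) R]
    (F : Type*) [NormedAddCommGroup F] [NormedSpace ℝ F]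
    (V : R → Type*) [∀ x, NormedAddCommGroup (V x)] [∀ x, InnerProductSpace ℝ (V x)]
    [TopologicalSpace (TotalSpace F V)] [FiberBundle F V]
    [MulAction G (TotalSpace F V)] where
  /-- the radius function -/
  ε : R → ℝ
  ε_pos : ∀ x, 0 < ε x
  ε_contMDiff : ContMDiff (𝓡 r) 𝓘(ℝ, ℝ) ∞ ε
  ε_smul : ∀ (g : G) (x : R), ε (g • x) = ε x
  /-- the diffeomorphism of `B(ε, V)` onto an open neighbourhood of `R` in `M` -/
  φ : OpenPartialHomeomorph (TotalSpace F V) M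
  source_eq : φ.source = bundleBall ε
  contMDiffOn : ContMDiffOn ((𝓡 r).prod 𝓘(ℝ, F)) (𝓡 m) ∞ φ φ.source
  contMDiffOn_symm : ContMDiffOn (𝓡 m) ((𝓡 r).prod 𝓘(ℝ, F)) ∞ φ.symm φ.target
  map_smul : ∀ (g : G), ∀ v ∈ φ.source, φ (g • v) = g • φ v
  map_zero : ∀ x : R, φ ⟨x, 0⟩ = (x : M)

namespace EquivariantTubularNeighborhood

variable {m r : ℕ} {G M : Type*} [Group G]
  [TopologicalSpace M] [ChartedSpace (EuclideanSpace ℝ (Fin m)) M] [MulAction G M]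
  {R : SubMulAction G M} [ChartedSpace (EuclideanSpace ℝ (Fin r)) R]
  {F : Type*} [NormedAddCommGroup F] [NormedSpace ℝ F]
  {V : R → Type*} [∀ x, NormedAddCommGroup (V x)] [∀ x, InnerProductSpace ℝ (V x)]
  [TopologicalSpace (TotalSpace F V)] [FiberBundle F V] [MulAction G (TotalSpace F V)]

/-- The projection `π_T` of the tube onto `R` (meaningful on the tube `T.φ.target`). -/
def proj (T : EquivariantTubularNeighborhood (m := m) (r := r) R F V) (x : M) : R :=
  (T.φ.symm x).proj

/-- The tubular function `ϱ_T` (meaningful on the tube `T.φ.target`). -/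
def rho (T : EquivariantTubularNeighborhood (m := m) (r := r) R F V) (x : M) : ℝ :=
  inner ℝ (T.φ.symm x).snd (T.φ.symm x).snd

/-- The shrunken tube `φ(B(ε, V) ∩ B(ε', V))`. -/
def shrink (T : EquivariantTubularNeighborhood (m := m) (r := r) R F V) (ε' : R → ℝ) : Set M :=
  T.φ '' (bundleBall T.ε ∩ bundleBall ε')

end EquivariantTubularNeighborhood

end

set_option linter.unusedSectionVars false

/-! ### Linear algebra and the Grassmannian -/

/-! The heart is local: near each `y ∈ R` the map `(π_T, ϱ_T)` is submersive along `S`. Otherwise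
there are bad points `x k ∈ S` tending to `y`. Put `z k = π_T (x k)`. By compactness one may assume
that the tangent spaces of `S` at `x k` converge to some `τ` and that the unit secants from `z k` to
`x k` converge to some `u`. Condition (B) gives `u ∈ τ`. Applied to other secants it also gives
condition (A), that `τ` contains the tangent space of `R` (`fderiv_tubeChartInv_mem_of_whitney`).

In a bundle chart `ϱ_T` becomes a function `n (a, f)`, quadratic in `f`, and `u` becomes a vertical
vector `(0, q)` with `q ≠ 0`. The differential of `ϱ_T` vanishes on `R`, so submersivity cannot
simply be read off at `y`. Divided by `‖x k - z k‖`, however, the differentials at `x k` converge to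
the second derivative `D²n (0, q)`, which kills horizontal vectors and has value `2 n (a₀, q) > 0`
on `(0, q)`. Hence the pair of `dπ_T` and the rescaled `dϱ_T`, composed with the projections onto
the tangent spaces, converges to an operator that is surjective already on `τ`. Surjectivity is
open, which contradicts the choice of `x k` (`eventually_surjective_of_subspaceTendsto`,
`eventually_surjective_mfderiv`).

The good points fill an open neighbourhood `Ω` of `R`. As `G` is compact, the points whose whole
orbit lies in `Ω` still form an open neighbourhood of `R`. A partition of unity gives a smooth
radius `f` for it, and Haar averaging makes the radius invariant. The average at a point is at most
the value of `f` somewhere on the orbit, which suffices because the tube and the neighbourhood are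
equivariant. -/

theorem ContinuousLinearMap.eventually_surjective_of_tendsto {ι X Y : Type*} {l : Filter ι}
    [NormedAddCommGroup X] [NormedSpace ℝ X] [NormedAddCommGroup Y] [NormedSpace ℝ Y]
    [FiniteDimensional ℝ Y] {Λ : ι → X →L[ℝ] Y} {Λ₀ : X →L[ℝ] Y} (h : Tendsto Λ l (𝓝 Λ₀))
    (hs : Function.Surjective Λ₀) : ∀ᶠ k in l, Function.Surjective (Λ k) := by
  obtain ⟨B, hB⟩ := Λ₀.toLinearMap.exists_rightInverse_of_surjective (LinearMap.range_eq_top.2 hs)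
  have : CompleteSpace Y := FiniteDimensional.complete ℝ Y
  let B' : Y →L[ℝ] X := B.toContinuousLinearMap
  have h1 : Λ₀ ∘L B' = 1 := by
    ext y
    exact LinearMap.congr_fun hB y
  have h2 : Tendsto (fun k => Λ k ∘L B') l (𝓝 (1 : Y →L[ℝ] Y)) := by
    rw [← h1]
    exact ((continuous_id.clm_comp continuous_const).tendsto Λ₀).comp h
  -- The invertible operators on `Y` form an open set around the identity, so `Λ k` composed with
  -- the fixed right inverse of `Λ₀` is eventually invertible.
  filter_upwards [h2 (Units.isOpen.mem_nhds (x := (1 : Y →L[ℝ] Y)) isUnit_one)] with k hk y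
  obtain ⟨e, he⟩ := hk
  refine ⟨B' (e⁻¹.1 y), ?_⟩
  have := DFunLike.congr_fun (e.mul_inv) y
  rw [he] at this
  exact this

theorem tendsto_clm_comp {ι X Y Z : Type*} {l : Filter ι}
    [NormedAddCommGroup X] [NormedSpace ℝ X] [NormedAddCommGroup Y] [NormedSpace ℝ Y]
    [NormedAddCommGroup Z] [NormedSpace ℝ Z] {g : ι → Y →L[ℝ] Z} {g₀ : Y →L[ℝ] Z}
    {f : ι → X →L[ℝ] Y} {f₀ : X →L[ℝ] Y} (hg : Tendsto g l (𝓝 g₀)) (hf : Tendsto f l (𝓝 f₀)) :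
    Tendsto (fun k => g k ∘L f k) l (𝓝 (g₀ ∘L f₀)) :=
  ((continuous_fst.clm_comp continuous_snd).tendsto (g₀, f₀)).comp (hg.prodMk_nhds hf)

theorem starProjection_span_singleton {E : Type*} [NormedAddCommGroup E] [InnerProductSpace ℝ E]
    (v : E) : (Submodule.span ℝ {v}).starProjection
      = (‖v‖ ^ 2)⁻¹ • (innerSL ℝ v).smulRight v := by
  ext w
  rw [Submodule.starProjection_singleton]
  simp [smul_smul, div_eq_inv_mul]

theorem subspaceTendsto_span_singleton {m : ℕ} {w : ℕ → EuclideanSpace ℝ (Fin m)}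
    {w₀ : EuclideanSpace ℝ (Fin m)} (hw₀ : w₀ ≠ 0) {c : ℕ → ℝ} (hc : ∀ᶠ k in atTop, c k ≠ 0)
    (h : Tendsto (fun k => c k • w k) atTop (𝓝 w₀)) :
    SubspaceTendsto (fun k => Submodule.span ℝ {w k}) (Submodule.span ℝ {w₀}) := by
  have hev : (fun k => (Submodule.span ℝ {c k • w k}).starProjection) =ᶠ[atTop]
      fun k => (Submodule.span ℝ {w k}).starProjection := by
    filter_upwards [hc] with k hk
    simp only [Submodule.span_singleton_smul_eq (IsUnit.mk0 _ hk)]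
  refine Tendsto.congr' hev ?_
  simp only [starProjection_span_singleton]
  refine Tendsto.smul ((h.norm.pow 2).inv₀ (by simpa using hw₀)) ?_
  have hcont : Continuous fun v : EuclideanSpace ℝ (Fin m) => (innerSL ℝ v).smulRight v := by
    fun_prop
  exact (hcont.tendsto w₀).comp h

/-- Compactness of the Grassmannian: orthogonal projections lie in the compact unit ball of
operators, and being idempotent and self-adjoint passes to limits. -/
theorem exists_subseq_subspaceTendsto {m : ℕ} (V : ℕ → Submodule ℝ (EuclideanSpace ℝ (Fin m))) :
    ∃ (τ : Submodule ℝ (EuclideanSpace ℝ (Fin m))) (ψ : ℕ → ℕ), StrictMono ψ ∧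
      SubspaceTendsto (fun k => V (ψ k)) τ := by
  have : ProperSpace (EuclideanSpace ℝ (Fin m) →L[ℝ] EuclideanSpace ℝ (Fin m)) :=
    FiniteDimensional.proper ℝ _
  obtain ⟨P, -, ψ, hψ, hP⟩ := (isCompact_closedBall
    (0 : EuclideanSpace ℝ (Fin m) →L[ℝ] EuclideanSpace ℝ (Fin m)) 1).tendsto_subseq
    (x := fun k => (V k).starProjection)
    (fun k => by simpa using Submodule.starProjection_norm_le (V k))
  have hproj : IsStarProjection P := by
    have h1 : ∀ k, IsStarProjection (V (ψ k)).starProjection :=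
      fun k => isStarProjection_starProjection
    refine ⟨tendsto_nhds_unique (hP.mul hP) (hP.congr fun k => ?_),
      tendsto_nhds_unique hP.star (hP.congr fun k => ?_)⟩
    · exact (h1 k).isIdempotentElem.eq.symm
    · exact (h1 k).isSelfAdjoint.star_eq.symm
  obtain ⟨τ, hτ, hPτ⟩ := isStarProjection_iff_eq_starProjection.1 hproj
  refine ⟨τ, ψ, hψ, ?_⟩
  rw [hPτ] at hP
  exact hP

/-! ### Local analysis near the smaller stratum -/

/-- Both ends of the secant move, so strict differentiability is what controls the error by `x k - z
k`. This is used for the tube chart and again for the differential of `n`. -/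
theorem HasStrictFDerivAt.tendsto_smul_sub {ι X Y : Type*} {l : Filter ι}
    [NormedAddCommGroup X] [NormedSpace ℝ X] [NormedAddCommGroup Y] [NormedSpace ℝ Y]
    {f : X → Y} {f' : X →L[ℝ] Y} {y : X} (hf : HasStrictFDerivAt f f' y) {x z : ι → X} {c : ι → ℝ}
    {u : X} (hx : Tendsto x l (𝓝 y)) (hz : Tendsto z l (𝓝 y))
    (hu : Tendsto (fun k => c k • (x k - z k)) l (𝓝 u)) :
    Tendsto (fun k => c k • (f (x k) - f (z k))) l (𝓝 (f' u)) := by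
  have h1 := hf.isLittleO.comp_tendsto (hx.prodMk_nhds hz)
  have h2 := ((Asymptotics.isBigO_refl c l).smul_isLittleO h1).trans_isBigO (hu.isBigO_one ℝ)
  have h3 := (Asymptotics.isLittleO_one_iff ℝ).1 h2
  have h4 := h3.add ((f'.continuous.tendsto u).comp hu)
  rw [zero_add] at h4
  refine h4.congr fun k => ?_
  simp [smul_sub, map_sub]

/-! ### Functions quadratic on the fibres: second derivatives on the zero section -/

section Quadratic

variable {A F : Type*} [NormedAddCommGroup A] [NormedSpace ℝ A] [NormedAddCommGroup F]
  [NormedSpace ℝ F] {n : A × F → ℝ} {a₀ : A}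

/-- A nonnegative function has a minimum wherever it vanishes. -/
theorem eventually_fderiv_zero_section_eq_zero
    (hom : ∀ᶠ a in 𝓝 a₀, ∀ (t : ℝ) (f : F), n (a, t • f) = t ^ 2 * n (a, f))
    (hnn : ∀ᶠ a in 𝓝 a₀, ∀ f : F, 0 ≤ n (a, f)) :
    ∀ᶠ a in 𝓝 a₀, fderiv ℝ n (a, 0) = 0 := by
  filter_upwards [hom, hnn.eventually_nhds] with a ha hb
  refine IsLocalMin.fderiv_eq_zero ?_
  have h0 : n (a, 0) = 0 := by simpa using ha 0 0
  filter_upwards [(continuous_fst.tendsto (a, (0 : F))).eventually hb] with b hb'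
  rw [h0]
  exact hb' b.2

/-- By symmetry this is the derivative of `fderiv ℝ n` along the zero section, where `fderiv ℝ n` is
identically zero. -/
theorem snd_fderiv_vertical_horizontal (hn : ContDiffAt ℝ 2 n (a₀, 0))
    (hom : ∀ᶠ a in 𝓝 a₀, ∀ (t : ℝ) (f : F), n (a, t • f) = t ^ 2 * n (a, f))
    (hnn : ∀ᶠ a in 𝓝 a₀, ∀ f : F, 0 ≤ n (a, f)) (q : F) (v : A) :
    fderiv ℝ (fderiv ℝ n) (a₀, 0) (0, q) (v, 0) = 0 := by
  have hsymm : IsSymmSndFDerivAt ℝ n (a₀, (0 : F)) := hn.isSymmSndFDerivAt (by simp)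
  rw [hsymm]
  have hd : DifferentiableAt ℝ (fderiv ℝ n) (a₀, (0 : F)) :=
    (hn.fderiv_right (m := 1) (by norm_num)).differentiableAt (by norm_num)
  have h1 : HasFDerivAt (fun a : A => fderiv ℝ n (a, 0))
      (fderiv ℝ (fderiv ℝ n) (a₀, 0) ∘L ContinuousLinearMap.inl ℝ A F) a₀ :=
    HasFDerivAt.comp (f := fun a : A => (a, (0 : F))) a₀ hd.hasFDerivAt (hasFDerivAt_prodMk_left a₀ 0)
  have h2 : HasFDerivAt (fun a : A => fderiv ℝ n (a, 0)) (0 : A →L[ℝ] A × F →L[ℝ] ℝ) a₀ :=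
    (hasFDerivAt_const (0 : A × F →L[ℝ] ℝ) a₀).congr_of_eventuallyEq
      (eventually_fderiv_zero_section_eq_zero hom hnn)
  have h3 := DFunLike.congr_fun (h1.unique h2) v
  have h4 := DFunLike.congr_fun h3 (0, q)
  simpa using h4

/-- On the ray `t ↦ (a₀, t • q)` the function is `t ^ 2 * n (a₀, q)`. The proof differentiates it
twice. -/
theorem snd_fderiv_vertical_vertical (hn : ContDiffAt ℝ 2 n (a₀, 0))
    (hom : ∀ (t : ℝ) (f : F), n (a₀, t • f) = t ^ 2 * n (a₀, f)) (q : F) :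
    fderiv ℝ (fderiv ℝ n) (a₀, 0) (0, q) (0, q) = 2 * n (a₀, q) := by
  have hd : DifferentiableAt ℝ (fderiv ℝ n) (a₀, (0 : F)) :=
    (hn.fderiv_right (m := 1) (by norm_num)).differentiableAt (by norm_num)
  have hγ (t : ℝ) : HasDerivAt (fun t : ℝ => (a₀, t • q)) ((0 : A), q) t :=
    (hasDerivAt_const t a₀).prodMk (by simpa using (hasDerivAt_id t).smul_const q)
  have hγ0 : (a₀, (0 : ℝ) • q) = (a₀, (0 : F)) := by simp
  have h1 : HasDerivAt (fun t : ℝ => fderiv ℝ n (a₀, t • q) (0, q))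
      (fderiv ℝ (fderiv ℝ n) (a₀, 0) (0, q) (0, q)) 0 := by
    have hd' : HasFDerivAt (fderiv ℝ n) (fderiv ℝ (fderiv ℝ n) (a₀, 0)) (a₀, (0 : ℝ) • q) := by
      rw [hγ0]
      exact hd.hasFDerivAt
    exact (ContinuousLinearMap.apply ℝ ℝ ((0 : A), q)).hasFDerivAt.comp_hasDerivAt (0 : ℝ)
      (hd'.comp_hasDerivAt (0 : ℝ) (hγ 0))
  have hdiff : ∀ᶠ t in 𝓝 (0 : ℝ), DifferentiableAt ℝ n (a₀, t • q) := by
    have h2 : ∀ᶠ b in 𝓝 (a₀, (0 : F)), DifferentiableAt ℝ n b :=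
      (hn.eventually (by simp)).mono fun b hb => hb.differentiableAt (by norm_num)
    rw [← hγ0] at h2
    exact (hγ 0).continuousAt.eventually h2
  have h2 : (fun t : ℝ => fderiv ℝ n (a₀, t • q) (0, q)) =ᶠ[𝓝 0] fun t => 2 * t * n (a₀, q) := by
    filter_upwards [hdiff] with t ht
    have e1 := ht.hasFDerivAt.comp_hasDerivAt t (hγ t)
    have e2 : HasDerivAt (fun t : ℝ => n (a₀, t • q)) (2 * t * n (a₀, q)) t := by
      simp only [hom]
      simpa using (hasDerivAt_pow 2 t).mul_const (n (a₀, q))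
    exact e1.unique e2
  have h3 : HasDerivAt (fun t : ℝ => 2 * t * n (a₀, q)) (2 * n (a₀, q)) 0 := by
    simpa using ((hasDerivAt_id (0 : ℝ)).const_mul 2).mul_const (n (a₀, q))
  exact h1.unique (h3.congr_of_eventuallyEq h2)

/-- If the tangent spaces `V k` at `x k` converge to a subspace `τ` that contains both the tangent
space of the smaller stratum and the limit `u` of the directions of the secants from `z k` to `x k`,
then `(p₁, n ∘ p)` is eventually submersive at `x k` along `V k`. -/
theorem eventually_surjective_of_subspaceTendsto [FiniteDimensional ℝ A] {m : ℕ}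
    {p : EuclideanSpace ℝ (Fin m) → A × F} {y : EuclideanSpace ℝ (Fin m)}
    (hp : ContDiffAt ℝ 2 p y) (hpy : p y = (a₀, 0)) (hinj : Function.Injective (fderiv ℝ p y))
    (hn : ContDiffAt ℝ 2 n (a₀, 0))
    (hom : ∀ᶠ a in 𝓝 a₀, ∀ (t : ℝ) (f : F), n (a, t • f) = t ^ 2 * n (a, f))
    (hnn : ∀ᶠ a in 𝓝 a₀, ∀ f : F, 0 ≤ n (a, f)) (hpos : ∀ f : F, f ≠ 0 → 0 < n (a₀, f))
    {x z : ℕ → EuclideanSpace ℝ (Fin m)} (hx : Tendsto x atTop (𝓝 y)) (hz : Tendsto z atTop (𝓝 y))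
    (hne : ∀ᶠ k in atTop, x k ≠ z k) (hpz : ∀ᶠ k in atTop, p (z k) = ((p (x k)).1, 0))
    {u : EuclideanSpace ℝ (Fin m)}
    (hu : Tendsto (fun k => ‖x k - z k‖⁻¹ • (x k - z k)) atTop (𝓝 u)) (hu0 : u ≠ 0)
    {V : ℕ → Submodule ℝ (EuclideanSpace ℝ (Fin m))}
    {τ : Submodule ℝ (EuclideanSpace ℝ (Fin m))} (hV : SubspaceTendsto V τ) (huτ : u ∈ τ)
    (hτ : ∀ v : A, ∃ w ∈ τ, fderiv ℝ p y w = (v, 0)) :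
    ∀ᶠ k in atTop, ∀ b : A × ℝ, ∃ w ∈ V k,
      (fderiv ℝ p (x k) w).1 = b.1 ∧ fderiv ℝ n (p (x k)) (fderiv ℝ p (x k) w) = b.2 := by
  have hps : HasStrictFDerivAt p (fderiv ℝ p y) y := hp.hasStrictFDerivAt (by norm_num)
  have hpd : ContinuousAt (fderiv ℝ p) y := (hp.fderiv_right (m := 1) (by norm_num)).continuousAt
  have hns : HasStrictFDerivAt (fderiv ℝ n) (fderiv ℝ (fderiv ℝ n) (a₀, 0)) (a₀, (0 : F)) :=
    (hn.fderiv_right (m := 1) (by norm_num)).hasStrictFDerivAt (by norm_num)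
  have hpx : Tendsto (fun k => p (x k)) atTop (𝓝 (a₀, 0)) := hpy ▸ hp.continuousAt.tendsto.comp hx
  have hpz' : Tendsto (fun k => p (z k)) atTop (𝓝 (a₀, 0)) := hpy ▸ hp.continuousAt.tendsto.comp hz
  have h1 := hps.tendsto_smul_sub hx hz hu
  -- The points `x k` and `z k` have the same base coordinate, so the limiting secant is vertical.
  have hfst : (fderiv ℝ p y u).1 = 0 := by
    refine tendsto_nhds_unique ((continuous_fst.tendsto _).comp h1) ?_
    refine tendsto_const_nhds.congr' ?_
    filter_upwards [hpz] with k hk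
    simp [hk]
  set q := (fderiv ℝ p y u).2 with hq
  have hpu : fderiv ℝ p y u = (0, q) := Prod.ext hfst rfl
  have hq0 : q ≠ 0 := by
    intro h0
    rw [h0] at hpu
    exact hu0 (hinj (by rw [hpu, map_zero]; rfl))
  have h2 := hns.tendsto_smul_sub hpx hpz' h1
  rw [hpu] at h2
  -- The difference quotient of `fderiv ℝ n` loses its second term, because `p (z k)` lies on the
  -- zero section.
  have h3 : Tendsto (fun k => ‖x k - z k‖⁻¹ • fderiv ℝ n (p (x k))) atTop
      (𝓝 (fderiv ℝ (fderiv ℝ n) (a₀, 0) (0, q))) := by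
    refine h2.congr' ?_
    have e1 := ((continuous_fst.tendsto _).comp hpx).eventually
      (eventually_fderiv_zero_section_eq_zero hom hnn)
    filter_upwards [hpz, e1] with k hk hk'
    rw [hk]
    simp only [Function.comp_apply] at hk'
    rw [hk', sub_zero]
  have hpxd : Tendsto (fun k => fderiv ℝ p (x k)) atTop (𝓝 (fderiv ℝ p y)) := hpd.tendsto.comp hx
  have hlim : Tendsto (fun k => ((ContinuousLinearMap.fst ℝ A F ∘L fderiv ℝ p (x k)).prod
        ((‖x k - z k‖⁻¹ • fderiv ℝ n (p (x k))) ∘L fderiv ℝ p (x k))) ∘L (V k).starProjection) atTop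
      (𝓝 (((ContinuousLinearMap.fst ℝ A F ∘L fderiv ℝ p y).prod
        (fderiv ℝ (fderiv ℝ n) (a₀, 0) (0, q) ∘L fderiv ℝ p y)) ∘L τ.starProjection)) := by
    refine tendsto_clm_comp ?_ hV
    have e1 := tendsto_clm_comp (tendsto_const_nhds (x := ContinuousLinearMap.fst ℝ A F)) hpxd
    have e2 := tendsto_clm_comp h3 hpxd
    exact ((ContinuousLinearMap.prodₗᵢ (𝕜 := ℝ) (E := EuclideanSpace ℝ (Fin m)) (F := A) (G := ℝ)
      ℝ).continuous.tendsto _).comp (e1.prodMk_nhds e2)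
  have hsurj := ContinuousLinearMap.eventually_surjective_of_tendsto hlim (by
    rintro ⟨v, t⟩
    obtain ⟨w, hw, hwv⟩ := hτ v
    have hpq := hpos q hq0
    -- The limit operator is triangular: `w` contributes `(v, 0)`, and `u` contributes `(0, 2 * n
    -- (a₀, q))`.
    refine ⟨w + (t / (2 * n (a₀, q))) • u, ?_⟩
    have hwτ := Submodule.starProjection_eq_self_iff.2 hw
    have huτ' := Submodule.starProjection_eq_self_iff.2 huτ
    have e1 := snd_fderiv_vertical_horizontal hn hom hnn q v
    have e2 := snd_fderiv_vertical_vertical hn hom.self_of_nhds q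
    simp only [ContinuousLinearMap.comp_apply, hwτ, huτ',
      ContinuousLinearMap.prod_apply, map_add, map_smul, hwv, hpu, e1, e2]
    ext
    · simp
    · simp
      field_simp)
  filter_upwards [hsurj, hne] with k hk hk' b
  -- Scaling the target's second coordinate undoes the normalisation of the differential.
  obtain ⟨w, hw⟩ := hk (b.1, ‖x k - z k‖⁻¹ * b.2)
  refine ⟨(V k).starProjection w, Submodule.starProjection_apply_mem _ _, ?_, ?_⟩
  · simpa using congrArg Prod.fst hw
  · have := congrArg Prod.snd hw
    have h0 : ‖x k - z k‖⁻¹ ≠ 0 := inv_ne_zero (norm_ne_zero_iff.2 (sub_ne_zero.2 hk'))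
    exact mul_left_cancel₀ h0 (by simpa using this)

end Quadratic

/-! ### Smoothness of integrals over a compact manifold -/

section ParametricIntegral

open MeasureTheory

/-- Dominated differentiation: compactness of a closed ball times `K` bounds the derivative by a
constant, integrable for a finite measure. -/
theorem hasFDerivAt_integral_of_compactSpace {E F K : Type*} [NormedAddCommGroup E]
    [NormedSpace ℝ E] [FiniteDimensional ℝ E] [NormedAddCommGroup F] [NormedSpace ℝ F]
    [TopologicalSpace K] [CompactSpace K] [SecondCountableTopology K] [MeasurableSpace K]
    [BorelSpace K] {μ : Measure K} [IsFiniteMeasure μ] {U : Set E} (hU : IsOpen U)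
    {f : E × K → F} {D : E × K → E →L[ℝ] F} (hf : ContinuousOn f (U ×ˢ univ))
    (hD : ContinuousOn D (U ×ˢ univ))
    (h : ∀ a ∈ U, ∀ g, HasFDerivAt (fun a' => f (a', g)) (D (a, g)) a) {a : E} (ha : a ∈ U) :
    HasFDerivAt (fun a => ∫ g, f (a, g) ∂μ) (∫ g, D (a, g) ∂μ) a := by
  have : ProperSpace E := FiniteDimensional.proper_real E
  have hfc {b : E} (hb : b ∈ U) : Continuous fun g => f (b, g) :=
    hf.comp_continuous (by fun_prop) fun g => ⟨hb, mem_univ g⟩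
  have hDc : Continuous fun g => D (a, g) :=
    hD.comp_continuous (by fun_prop) fun g => ⟨ha, mem_univ g⟩
  obtain ⟨δ, hδ, hball⟩ := Metric.nhds_basis_closedBall.mem_iff.1 (hU.mem_nhds ha)
  obtain ⟨C, hC⟩ := ((isCompact_closedBall a δ).prod (isCompact_univ (X := K))).bddAbove_image
    (hD.mono (prod_mono hball subset_rfl)).norm
  refine hasFDerivAt_integral_of_dominated_of_fderiv_le (F := fun a g => f (a, g))
    (F' := fun a g => D (a, g)) (bound := fun _ => C)
    (Metric.closedBall_mem_nhds a hδ) ?_ ?_ ?_ ?_ (integrable_const C) ?_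
  · filter_upwards [hU.mem_nhds ha] with b hb
    exact (hfc hb).aestronglyMeasurable
  · exact (hfc ha).integrable_of_hasCompactSupport (HasCompactSupport.of_compactSpace _)
  · exact hDc.aestronglyMeasurable
  · exact ae_of_all _ fun g b hb => hC (mem_image_of_mem _ (mk_mem_prod hb (mem_univ g)))
  · exact ae_of_all _ fun g b hb => h b (hball hb) g

variable {EK H K : Type*} [NormedAddCommGroup EK] [NormedSpace ℝ EK] [TopologicalSpace H]
  {I : ModelWithCorners ℝ EK H} [TopologicalSpace K] [ChartedSpace H K] [IsManifold I ∞ K]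

theorem contMDiffOn_partial_fderiv {E F : Type*} [NormedAddCommGroup E] [NormedSpace ℝ E]
    [NormedAddCommGroup F] [NormedSpace ℝ F] {U : Set E} (hU : IsOpen U) {f : E × K → F}
    (hf : ContMDiffOn (𝓘(ℝ, E).prod I) 𝓘(ℝ, F) ∞ f (U ×ˢ univ)) :
    ContMDiffOn (𝓘(ℝ, E).prod I) 𝓘(ℝ, E →L[ℝ] F) ∞
      (fun b : E × K => fderiv ℝ (fun a => f (a, b.2)) b.1) (U ×ˢ univ) := by
  intro b hb
  have hfb : ContMDiffAt (𝓘(ℝ, E).prod I) 𝓘(ℝ, F) ∞ f (b.1, b.2) :=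
    (hf b hb).contMDiffAt ((hU.prod isOpen_univ).mem_nhds hb)
  have h := ContMDiffAt.mfderiv (J := 𝓘(ℝ, E).prod I) (I := 𝓘(ℝ, E)) (I' := 𝓘(ℝ, F)) (n := ∞)
    (m := ∞) (x₀ := b) (fun (c : E × K) (a : E) => f (a, c.2)) (fun c : E × K => c.1)
    (hfb.comp (I' := 𝓘(ℝ, E).prod I) (f := fun d : (E × K) × E => (d.2, d.1.2)) (b, b.1)
      (contMDiffAt_snd.prodMk (contMDiffAt_snd.comp _ contMDiffAt_fst)))
    contMDiffAt_fst (by simp)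
  have e := inTangentCoordinates_model_space (I := 𝓘(ℝ, E)) (I' := 𝓘(ℝ, F)) (fun c : E × K => c.1)
    (fun c => f (c.1, c.2)) (fun c => fderiv ℝ (fun a => f (a, c.2)) c.1) b
  rw [← e]
  simpa only [mfderiv_eq_fderiv] using h.contMDiffWithinAt

theorem hasFDerivAt_integral_of_contMDiffOn {E F : Type*} [NormedAddCommGroup E]
    [NormedSpace ℝ E] [FiniteDimensional ℝ E] [NormedAddCommGroup F] [NormedSpace ℝ F]
    [CompactSpace K] [SecondCountableTopology K] [MeasurableSpace K]
    [BorelSpace K] (μ : Measure K) [IsFiniteMeasure μ] {U : Set E} (hU : IsOpen U)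
    {f : E × K → F} (hf : ContMDiffOn (𝓘(ℝ, E).prod I) 𝓘(ℝ, F) ∞ f (U ×ˢ univ))
    {a : E} (ha : a ∈ U) :
    HasFDerivAt (fun a => ∫ g, f (a, g) ∂μ) (∫ g, fderiv ℝ (fun a' => f (a', g)) a ∂μ) a := by
  refine hasFDerivAt_integral_of_compactSpace (D := fun b => fderiv ℝ (fun a => f (a, b.2)) b.1)
    hU hf.continuousOn (contMDiffOn_partial_fderiv hU hf).continuousOn ?_ ha
  intro b hb g
  have hfb : ContMDiffAt (𝓘(ℝ, E).prod I) 𝓘(ℝ, F) ∞ f (b, g) :=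
    (hf (b, g) ⟨hb, mem_univ g⟩).contMDiffAt ((hU.prod isOpen_univ).mem_nhds ⟨hb, mem_univ g⟩)
  have : ContMDiffAt 𝓘(ℝ, E) 𝓘(ℝ, F) ∞ (fun a => f (a, g)) b :=
    hfb.comp (f := fun a : E => (a, g)) b (contMDiffAt_id.prodMk contMDiffAt_const)
  exact (this.contDiffAt.differentiableAt (by simp)).hasFDerivAt

/-- The induction replaces `F` by `E →L[ℝ] F`, so both spaces are kept in one fixed universe. -/
theorem contDiffOn_integral_nat {E F : Type} [NormedAddCommGroup E] [NormedSpace ℝ E]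
    [FiniteDimensional ℝ E] [NormedAddCommGroup F] [NormedSpace ℝ F] [CompactSpace K]
    [SecondCountableTopology K] [MeasurableSpace K]
    [BorelSpace K] (μ : Measure K) [IsFiniteMeasure μ] {U : Set E} (hU : IsOpen U)
    {f : E × K → F} (hf : ContMDiffOn (𝓘(ℝ, E).prod I) 𝓘(ℝ, F) ∞ f (U ×ˢ univ)) (n : ℕ) :
    ContDiffOn ℝ n (fun a => ∫ g, f (a, g) ∂μ) U := by
  induction n generalizing F with
  | zero =>
    exact contDiffOn_zero.2 fun a ha =>
      (hasFDerivAt_integral_of_contMDiffOn μ hU hf ha).continuousAt.continuousWithinAt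
  | succ n ih =>
    push_cast
    rw [contDiffOn_succ_iff_hasFDerivWithinAt_of_uniqueDiffOn hU.uniqueDiffOn]
    exact ⟨by simp, fun a => ∫ g, fderiv ℝ (fun a' => f (a', g)) a ∂μ,
      ih (contMDiffOn_partial_fderiv hU hf),
      fun a ha => (hasFDerivAt_integral_of_contMDiffOn μ hU hf ha).hasFDerivWithinAt⟩

/-- The integral over a compact manifold of a smooth function of two variables is smooth. -/
theorem contMDiff_integral {r : ℕ} {N : Type*} [TopologicalSpace N]
    [ChartedSpace (EuclideanSpace ℝ (Fin r)) N] [IsManifold (𝓡 r) ∞ N] [CompactSpace K]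
    [SecondCountableTopology K] [MeasurableSpace K] [BorelSpace K] (μ : Measure K)
    [IsFiniteMeasure μ] {f : N × K → ℝ} (hf : ContMDiff ((𝓡 r).prod I) 𝓘(ℝ, ℝ) ∞ f) :
    ContMDiff (𝓡 r) 𝓘(ℝ, ℝ) ∞ (fun x => ∫ g, f (x, g) ∂μ) := by
  intro x
  have hopen : IsOpen (extChartAt (𝓡 r) x).target := isOpen_extChartAt_target x
  have h1 : ContMDiffOn (𝓘(ℝ, EuclideanSpace ℝ (Fin r)).prod I) 𝓘(ℝ, ℝ) ∞
      (fun b : EuclideanSpace ℝ (Fin r) × K => f ((extChartAt (𝓡 r) x).symm b.1, b.2))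
      ((extChartAt (𝓡 r) x).target ×ˢ univ) := by
    refine hf.comp_contMDiffOn (ContMDiffOn.prodMk ?_ contMDiffOn_snd)
    exact (contMDiffOn_extChartAt_symm x).comp contMDiffOn_fst fun b hb => hb.1
  have h2 : ContDiffOn ℝ ∞ (fun a => ∫ g, f ((extChartAt (𝓡 r) x).symm a, g) ∂μ)
      (extChartAt (𝓡 r) x).target :=
    contDiffOn_infty.2 (contDiffOn_integral_nat μ hopen h1)
  have h3 : ContMDiffAt (𝓡 r) 𝓘(ℝ, ℝ) ∞
      (fun z => ∫ g, f ((extChartAt (𝓡 r) x).symm (extChartAt (𝓡 r) x z), g) ∂μ) x :=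
    ContMDiffAt.comp (I' := 𝓘(ℝ, EuclideanSpace ℝ (Fin r)))
      (g := fun a => ∫ g, f ((extChartAt (𝓡 r) x).symm a, g) ∂μ) (f := extChartAt (𝓡 r) x) x
      (h2.contDiffAt (hopen.mem_nhds (mem_extChartAt_target x))).contMDiffAt contMDiffAt_extChartAt
  refine h3.congr_of_eventuallyEq ?_
  filter_upwards [extChartAt_source_mem_nhds (I := 𝓡 r) x] with z hz
  rw [(extChartAt (𝓡 r) x).left_inv hz]

end ParametricIntegral

/-! ### Riemannian vector bundles in bundle charts -/

section BundleCharts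

variable {r : ℕ} {B : Type*} [TopologicalSpace B] [ChartedSpace (EuclideanSpace ℝ (Fin r)) B]
  {F : Type*} [NormedAddCommGroup F] [NormedSpace ℝ F]
  {V : B → Type*} [∀ x, NormedAddCommGroup (V x)] [∀ x, InnerProductSpace ℝ (V x)]
  [TopologicalSpace (TotalSpace F V)] [FiberBundle F V]

/-- The function `v ↦ ⟨v, v⟩` on the total space of a bundle of inner product spaces. -/
noncomputable def fiberNormSq (v : TotalSpace F V) : ℝ := inner ℝ v.snd v.snd

theorem fiberNormSq_nonneg (v : TotalSpace F V) : 0 ≤ fiberNormSq v := real_inner_self_nonneg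

theorem contMDiff_fiberNormSq [VectorBundle ℝ F V] [IsContMDiffRiemannianBundle (𝓡 r) ∞ F V] :
    ContMDiff ((𝓡 r).prod 𝓘(ℝ, F)) 𝓘(ℝ, ℝ) ∞ (fiberNormSq : TotalSpace F V → ℝ) :=
  ContMDiff.inner_bundle (IB := 𝓡 r) (b := fun v : TotalSpace F V => v.proj)
    (v := fun v => v.snd) (w := fun v => v.snd) contMDiff_id contMDiff_id

theorem extChartAt_totalSpace_apply (y : B) {v : TotalSpace F V}
    (hv : v.proj ∈ (trivializationAt F V y).baseSet) :
    extChartAt ((𝓡 r).prod 𝓘(ℝ, F)) (⟨y, 0⟩ : TotalSpace F V) v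
      = (extChartAt (𝓡 r) y v.proj, (trivializationAt F V y v).2) := by
  rw [FiberBundle.extChartAt]
  simp [(trivializationAt F V y).coe_fst' hv]

theorem extChartAt_totalSpace_zero [VectorBundle ℝ F V] (y : B) {z : B}
    (hz : z ∈ (trivializationAt F V y).baseSet) :
    extChartAt ((𝓡 r).prod 𝓘(ℝ, F)) (⟨y, 0⟩ : TotalSpace F V) ⟨z, 0⟩
      = (extChartAt (𝓡 r) y z, 0) := by
  rw [extChartAt_totalSpace_apply y hz, ((trivializationAt F V y).linear ℝ hz).map_zero]

theorem extChartAt_totalSpace_symm_apply (y : B) {a : EuclideanSpace ℝ (Fin r)}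
    (ha : (extChartAt (𝓡 r) y).symm a ∈ (trivializationAt F V y).baseSet) (f : F) :
    (extChartAt ((𝓡 r).prod 𝓘(ℝ, F)) (⟨y, 0⟩ : TotalSpace F V)).symm (a, f)
      = ⟨(extChartAt (𝓡 r) y).symm a,
          (trivializationAt F V y).symm ((extChartAt (𝓡 r) y).symm a) f⟩ := by
  rw [FiberBundle.extChartAt, (trivializationAt F V y).mk_symm ha]
  simp

theorem eventually_extChartAt_symm_mem_baseSet (y : B) :
    ∀ᶠ a in 𝓝 (extChartAt (𝓡 r) y y),
      (extChartAt (𝓡 r) y).symm a ∈ (trivializationAt F V y).baseSet := by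
  refine (continuousAt_extChartAt_symm (I := 𝓡 r) y).eventually ?_
  rw [extChartAt_to_inv]
  exact (trivializationAt F V y).open_baseSet.mem_nhds (FiberBundle.mem_baseSet_trivializationAt' y)

variable (F V) in
/-- The function `v ↦ ⟨v, v⟩` in the bundle chart at `y`. -/
noncomputable def chartNormSq (y : B) (b : EuclideanSpace ℝ (Fin r) × F) : ℝ :=
  fiberNormSq ((extChartAt ((𝓡 r).prod 𝓘(ℝ, F)) (⟨y, 0⟩ : TotalSpace F V)).symm b)

theorem chartNormSq_nonneg (y : B) (b : EuclideanSpace ℝ (Fin r) × F) :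
    0 ≤ chartNormSq F V y b :=
  fiberNormSq_nonneg _

theorem chartNormSq_apply [VectorBundle ℝ F V] (y : B) {a : EuclideanSpace ℝ (Fin r)}
    (ha : (extChartAt (𝓡 r) y).symm a ∈ (trivializationAt F V y).baseSet) (f : F) :
    chartNormSq F V y (a, f) =
      inner ℝ ((trivializationAt F V y).symmL ℝ ((extChartAt (𝓡 r) y).symm a) f)
        ((trivializationAt F V y).symmL ℝ ((extChartAt (𝓡 r) y).symm a) f) := by
  rw [chartNormSq, extChartAt_totalSpace_symm_apply y ha, Trivialization.symmL_apply]
  · rfl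
  · exact ha

theorem eventually_chartNormSq_smul [VectorBundle ℝ F V] (y : B) :
    ∀ᶠ a in 𝓝 (extChartAt (𝓡 r) y y), ∀ (t : ℝ) (f : F),
      chartNormSq F V y (a, t • f) = t ^ 2 * chartNormSq F V y (a, f) := by
  filter_upwards [eventually_extChartAt_symm_mem_baseSet (r := r) (F := F) (V := V) y] with a ha t f
  rw [chartNormSq_apply y ha, chartNormSq_apply y ha, map_smul, real_inner_smul_left,
    real_inner_smul_right]
  ring

theorem chartNormSq_pos [VectorBundle ℝ F V] (y : B) {f : F} (hf : f ≠ 0) :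
    0 < chartNormSq F V y (extChartAt (𝓡 r) y y, f) := by
  have ha := (eventually_extChartAt_symm_mem_baseSet (r := r) (F := F) (V := V) y).self_of_nhds
  rw [chartNormSq_apply y ha, real_inner_self_pos]
  intro h0
  have h1 := (trivializationAt F V y).continuousLinearMapAt_symmL (R := ℝ) ha f
  rw [h0, map_zero] at h1
  exact hf h1.symm

theorem contDiffAt_chartNormSq [VectorBundle ℝ F V] [IsManifold (𝓡 r) ∞ B]
    [ContMDiffVectorBundle ∞ F V (𝓡 r)] [IsContMDiffRiemannianBundle (𝓡 r) ∞ F V] (y : B) :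
    ContDiffAt ℝ ∞ (chartNormSq (r := r) F V y) (extChartAt (𝓡 r) y y, 0) := by
  have h0 := extChartAt_totalSpace_zero (r := r) (F := F) (V := V) y
    (FiberBundle.mem_baseSet_trivializationAt' y)
  have h1 : ContMDiffAt 𝓘(ℝ, EuclideanSpace ℝ (Fin r) × F) ((𝓡 r).prod 𝓘(ℝ, F)) ∞
      (extChartAt ((𝓡 r).prod 𝓘(ℝ, F)) (⟨y, 0⟩ : TotalSpace F V)).symm
      (extChartAt (𝓡 r) y y, 0) := by
    rw [← h0]
    exact (contMDiffOn_extChartAt_symm _).contMDiffAt (extChartAt_target_mem_nhds _)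
  exact ((contMDiff_fiberNormSq (r := r) (F := F) (V := V)).contMDiffAt.comp _ h1).contDiffAt

end BundleCharts

/-! ### Auxiliary results on Whitney's condition, group actions and bundles -/

/-- Whitney's condition (B) at a point, for sequences that lie eventually in the chart domain. -/
theorem le_of_whitney_of_eventually {m s : ℕ} {M S : Type*} [TopologicalSpace M]
    [TopologicalSpace S] [ChartedSpace (EuclideanSpace ℝ (Fin s)) S]
    {i : S → M} {R : Set M} {c : OpenPartialHomeomorph M (EuclideanSpace ℝ (Fin m))} {y : M}
    (h : ∀ (x : ℕ → S) (z : ℕ → M) (τ ℓ : Submodule ℝ (EuclideanSpace ℝ (Fin m))),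
      (∀ k, i (x k) ∈ c.source) → (∀ k, z k ∈ R ∩ c.source) →
      Tendsto (fun k => i (x k)) atTop (𝓝 y) → Tendsto z atTop (𝓝 y) →
      SubspaceTendsto (fun k => tangentInChart (s := s) i c (x k)) τ →
      SubspaceTendsto (fun k => Submodule.span ℝ {c (i (x k)) - c (z k)}) ℓ → ℓ ≤ τ)
    (hy : y ∈ c.source) {x : ℕ → S} {z : ℕ → M}
    {τ ℓ : Submodule ℝ (EuclideanSpace ℝ (Fin m))} (hzR : ∀ k, z k ∈ R)
    (hx : Tendsto (fun k => i (x k)) atTop (𝓝 y)) (hz : Tendsto z atTop (𝓝 y))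
    (hτ : SubspaceTendsto (fun k => tangentInChart (s := s) i c (x k)) τ)
    (hℓ : SubspaceTendsto (fun k => Submodule.span ℝ {c (i (x k)) - c (z k)}) ℓ) : ℓ ≤ τ := by
  have hev := (hx.eventually (c.open_source.mem_nhds hy)).and
    (hz.eventually (c.open_source.mem_nhds hy))
  obtain ⟨N, hN⟩ := eventually_atTop.1 hev
  have hs := tendsto_add_atTop_nat N
  exact h (fun k => x (k + N)) (fun k => z (k + N)) τ ℓ (fun k => (hN _ (by omega)).1)
    (fun k => ⟨hzR _, (hN _ (by omega)).2⟩) (hx.comp hs) (hz.comp hs) (hτ.comp hs) (hℓ.comp hs)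

/-- The complement is the projection of a closed subset of `G × M` along the compact factor. -/
theorem isOpen_setOf_forall_smul_mem {G M : Type*} [TopologicalSpace G] [CompactSpace G]
    [TopologicalSpace M] [SMul G M] (h : Continuous fun p : G × M => p.1 • p.2) {Ω : Set M}
    (hΩ : IsOpen Ω) : IsOpen {x : M | ∀ g : G, g • x ∈ Ω} := by
  have h1 := isClosedMap_snd_of_compactSpace _ (hΩ.preimage h).isClosed_compl
  rw [← isClosed_compl_iff]
  convert h1 using 1
  ext x
  simp

theorem IsContMDiffRiemannianBundle.isContinuousRiemannianBundle {r : ℕ} {B : Type*}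
    [TopologicalSpace B] [ChartedSpace (EuclideanSpace ℝ (Fin r)) B]
    {F : Type*} [NormedAddCommGroup F] [NormedSpace ℝ F]
    {V : B → Type*} [∀ x, NormedAddCommGroup (V x)] [∀ x, InnerProductSpace ℝ (V x)]
    [TopologicalSpace (TotalSpace F V)] [FiberBundle F V] [VectorBundle ℝ F V]
    [IsContMDiffRiemannianBundle (𝓡 r) ∞ F V] : IsContinuousRiemannianBundle F V := by
  obtain ⟨g, hg, hg'⟩ := IsContMDiffRiemannianBundle.exists_contMDiff (IB := 𝓡 r) (n := ∞)
    (F := F) (E := V)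
  exact ⟨g, hg.continuous, hg'⟩

/-- The zero vector at `x` has a basis of neighbourhoods of the form
`{v | π v ∈ U, ⟨v, v⟩ < δ}`. -/
theorem exists_fiberNormSq_lt_subset {B F : Type*} [TopologicalSpace B]
    [NormedAddCommGroup F] [NormedSpace ℝ F]
    {V : B → Type*} [∀ x, NormedAddCommGroup (V x)] [∀ x, InnerProductSpace ℝ (V x)]
    [TopologicalSpace (TotalSpace F V)] [FiberBundle F V] [VectorBundle ℝ F V]
    [IsContinuousRiemannianBundle F V] (x : B) {O : Set (TotalSpace F V)}
    (hO : O ∈ 𝓝 (⟨x, 0⟩ : TotalSpace F V)) :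
    ∃ δ > 0, ∀ᶠ y in 𝓝 x, ∀ v : TotalSpace F V, v.proj = y → fiberNormSq v < δ → v ∈ O := by
  set e := trivializationAt F V x
  have hxb : x ∈ e.baseSet := FiberBundle.mem_baseSet_trivializationAt' x
  have hx : (⟨x, 0⟩ : TotalSpace F V) ∈ e.source := e.mem_source.2 hxb
  have hex : e ⟨x, 0⟩ = (x, 0) :=
    Prod.ext (e.coe_fst hx) (e.linear ℝ hxb).map_zero
  have hsymm : Tendsto e.toOpenPartialHomeomorph.symm (𝓝 (x, 0)) (𝓝 ⟨x, 0⟩) := by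
    have := e.toOpenPartialHomeomorph.continuousAt_symm (e.toOpenPartialHomeomorph.map_source hx)
    have h2 := this.tendsto
    rw [e.toOpenPartialHomeomorph.left_inv hx] at h2
    rwa [← hex]
  have h1 := hsymm hO
  rw [mem_map, nhds_prod_eq, mem_prod_iff] at h1
  obtain ⟨U, hU, W, hW, hUW⟩ := h1
  obtain ⟨η, hη, hηW⟩ := Metric.mem_nhds_iff.1 hW
  obtain ⟨C, hC, hCe⟩ := eventually_norm_trivializationAt_lt F V x
  -- Near `x` the trivialisation has operator norm below `C`, so vectors shorter than `η / C` have
  -- fibre coordinate below `η`.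
  refine ⟨(η / C) ^ 2, by positivity, ?_⟩
  filter_upwards [hU, hCe, e.open_baseSet.mem_nhds hxb] with y hyU hyC hyb
  rintro ⟨_, w⟩ rfl hvδ
  have hw : ‖w‖ < η / C := by
    refine lt_of_pow_lt_pow_left₀ 2 (by positivity) ?_
    rwa [← real_inner_self_eq_norm_sq]
  have hvs : (⟨_, w⟩ : TotalSpace F V) ∈ e.source := e.mem_source.2 hyb
  have hnorm : ‖(e ⟨_, w⟩).2‖ < η := by
    have h2 := (e.continuousLinearMapAt ℝ _).le_of_opNorm_le hyC.le w
    rw [e.continuousLinearMapAt_apply (R := ℝ), e.coe_linearMapAt_of_mem hyb] at h2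
    calc _ ≤ C * ‖w‖ := h2
      _ < C * (η / C) := by gcongr
      _ = η := by field_simp
  have hmem : e ⟨_, w⟩ ∈ U ×ˢ W := by
    refine ⟨?_, hηW (by simpa using hnorm)⟩
    rw [e.coe_fst hvs]
    exact hyU
  have := hUW hmem
  rwa [mem_preimage, ← e.coe_coe, e.toOpenPartialHomeomorph.left_inv hvs] at this

/-- The average of a smooth positive function over a compact Lie group. -/
theorem exists_invariant_average {d r : ℕ} {G : Type*} [TopologicalSpace G]
    [ChartedSpace (EuclideanSpace ℝ (Fin d)) G] [Group G] [LieGroup (𝓡 d) ∞ G] [CompactSpace G]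
    {N : Type*} [TopologicalSpace N] [ChartedSpace (EuclideanSpace ℝ (Fin r)) N]
    [IsManifold (𝓡 r) ∞ N] [MulAction G N]
    (hsmul : ContMDiff ((𝓡 r).prod (𝓡 d)) (𝓡 r) ∞ fun p : N × G => p.2⁻¹ • p.1)
    {f : N → ℝ} (hf : ContMDiff (𝓡 r) 𝓘(ℝ, ℝ) ∞ f) (hpos : ∀ x, 0 < f x) :
    ∃ f' : N → ℝ, ContMDiff (𝓡 r) 𝓘(ℝ, ℝ) ∞ f' ∧ (∀ x, 0 < f' x) ∧
      (∀ (g : G) (x : N), f' (g • x) = f' x) ∧ ∀ x, ∃ g : G, f' x ≤ f (g⁻¹ • x) := by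
  have : IsTopologicalGroup G := topologicalGroup_of_lieGroup (𝓡 d) ∞
  have : SecondCountableTopology G :=
    ChartedSpace.secondCountable_of_sigmaCompact (EuclideanSpace ℝ (Fin d)) G
  let : MeasurableSpace G := borel G
  have : BorelSpace G := ⟨rfl⟩
  set μ := MeasureTheory.Measure.haarMeasure (⊤ : TopologicalSpace.PositiveCompacts G)
  have hμ : MeasureTheory.IsProbabilityMeasure μ :=
    ⟨MeasureTheory.Measure.haarMeasure_self⟩
  have hF : ContMDiff ((𝓡 r).prod (𝓡 d)) 𝓘(ℝ, ℝ) ∞ fun p : N × G => f (p.2⁻¹ • p.1) :=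
    hf.comp hsmul
  have hcont (x : N) : Continuous fun g : G => f (g⁻¹ • x) :=
    hF.continuous.comp (Continuous.prodMk continuous_const continuous_id)
  have hfint (x : N) : MeasureTheory.Integrable (fun g : G => f (g⁻¹ • x)) μ :=
    (hcont x).integrable_of_hasCompactSupport (HasCompactSupport.of_compactSpace _)
  refine ⟨fun x => ∫ g : G, f (g⁻¹ • x) ∂μ, contMDiff_integral (I := 𝓡 d) μ hF, fun x => ?_,
    fun h x => ?_, fun x => MeasureTheory.exists_integral_le (hfint x)⟩
  · exact MeasureTheory.integral_pos_of_integrable_nonneg_nonzero (x := 1) (hcont x) (hfint x)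
      (fun g => (hpos _).le) (hpos _).ne'
  · change ∫ g : G, f (g⁻¹ • h • x) ∂μ = ∫ g : G, f (g⁻¹ • x) ∂μ
    -- Averaging over `g⁻¹ • x` turns the action of `h` on `x` into left translation of `g` by
    -- `h⁻¹`.
    rw [← MeasureTheory.integral_mul_left_eq_self (fun g : G => f (g⁻¹ • x)) h⁻¹]
    simp [mul_smul]

/-! ### Tubular neighbourhoods -/

namespace EquivariantTubularNeighborhood

variable {m r : ℕ} {G M : Type*} [Group G]
  [TopologicalSpace M] [ChartedSpace (EuclideanSpace ℝ (Fin m)) M] [MulAction G M]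
  {R : SubMulAction G M} [ChartedSpace (EuclideanSpace ℝ (Fin r)) R]
  {F : Type*} [NormedAddCommGroup F] [NormedSpace ℝ F]
  {V : R → Type*} [∀ x, NormedAddCommGroup (V x)] [∀ x, InnerProductSpace ℝ (V x)]
  [TopologicalSpace (TotalSpace F V)] [FiberBundle F V] [MulAction G (TotalSpace F V)]

section Basic

variable (T : EquivariantTubularNeighborhood (m := m) (r := r) R F V)

theorem zero_mem_source (x : R) : (⟨x, 0⟩ : TotalSpace F V) ∈ T.φ.source := by
  rw [T.source_eq]
  simpa [bundleBall] using T.ε_pos x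

theorem coe_mem_target (x : R) : (x : M) ∈ T.φ.target := by
  rw [← T.map_zero x]
  exact T.φ.map_source (T.zero_mem_source x)

theorem symm_coe (x : R) : T.φ.symm (x : M) = ⟨x, 0⟩ := by
  rw [← T.map_zero x]
  exact T.φ.left_inv (T.zero_mem_source x)

theorem proj_coe (x : R) : T.proj (x : M) = x := by
  rw [proj, T.symm_coe]

theorem contMDiffOn_proj [IsManifold (𝓡 r) ∞ R] [VectorBundle ℝ F V]
    [ContMDiffVectorBundle ∞ F V (𝓡 r)] :
    ContMDiffOn (𝓡 m) (𝓡 r) ∞ T.proj T.φ.target :=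
  (contMDiff_proj V).comp_contMDiffOn T.contMDiffOn_symm

theorem contMDiffOn_rho [VectorBundle ℝ F V] [IsContMDiffRiemannianBundle (𝓡 r) ∞ F V] :
    ContMDiffOn (𝓡 m) 𝓘(ℝ, ℝ) ∞ T.rho T.φ.target :=
  contMDiff_fiberNormSq.comp_contMDiffOn T.contMDiffOn_symm

end Basic

/-! ### The tubular diffeomorphism in charts -/

section Charts

variable (T : EquivariantTubularNeighborhood (m := m) (r := r) R F V)
  (c : OpenPartialHomeomorph M (EuclideanSpace ℝ (Fin m))) (y : R)

/-- The inverse of the tubular diffeomorphism, read in the chart `c` of `M` and in the bundle chart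
at `y`. -/
noncomputable def tubeChart (w : EuclideanSpace ℝ (Fin m)) : EuclideanSpace ℝ (Fin r) × F :=
  extChartAt ((𝓡 r).prod 𝓘(ℝ, F)) (⟨y, 0⟩ : TotalSpace F V) (T.φ.symm (c.symm w))

/-- The tubular diffeomorphism, read in the bundle chart at `y` and in the chart `c` of `M`. -/
noncomputable def tubeChartInv (b : EuclideanSpace ℝ (Fin r) × F) : EuclideanSpace ℝ (Fin m) :=
  c (T.φ ((extChartAt ((𝓡 r).prod 𝓘(ℝ, F)) (⟨y, 0⟩ : TotalSpace F V)).symm b))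

variable {c y}

theorem tubeChart_coe [VectorBundle ℝ F V] {z : R} (hz : (z : M) ∈ c.source)
    (hzb : z ∈ (trivializationAt F V y).baseSet) :
    T.tubeChart c y (c z) = (extChartAt (𝓡 r) y z, 0) := by
  rw [tubeChart, c.left_inv hz, T.symm_coe, extChartAt_totalSpace_zero y hzb]

theorem tubeChart_self [VectorBundle ℝ F V] (hy : (y : M) ∈ c.source) :
    T.tubeChart c y (c y) = (extChartAt (𝓡 r) y y, 0) :=
  T.tubeChart_coe hy (FiberBundle.mem_baseSet_trivializationAt' y)

theorem tubeChart_fst {x : M} (hx : x ∈ c.source)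
    (hxb : T.proj x ∈ (trivializationAt F V y).baseSet) :
    (T.tubeChart c y (c x)).1 = extChartAt (𝓡 r) y (T.proj x) := by
  rw [tubeChart, c.left_inv hx, extChartAt_totalSpace_apply y hxb]
  rfl

theorem continuousAt_symm : ContinuousAt T.φ.symm (y : M) :=
  T.φ.continuousAt_symm (T.coe_mem_target y)

variable (y) in
theorem eventually_symm_mem_source :
    ∀ᶠ x in 𝓝 (y : M), T.φ.symm x ∈
      (extChartAt ((𝓡 r).prod 𝓘(ℝ, F)) (⟨y, 0⟩ : TotalSpace F V)).source := by
  refine T.continuousAt_symm.eventually ?_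
  rw [T.symm_coe]
  exact extChartAt_source_mem_nhds _

theorem chartNormSq_tubeChart {x : M} (hx : x ∈ c.source) (hx' : T.φ.symm x ∈
      (extChartAt ((𝓡 r).prod 𝓘(ℝ, F)) (⟨y, 0⟩ : TotalSpace F V)).source) :
    chartNormSq F V y (T.tubeChart c y (c x)) = T.rho x := by
  rw [chartNormSq, tubeChart, c.left_inv hx, PartialEquiv.left_inv _ hx']
  rfl

theorem tubeChartInv_tubeChart (hy : (y : M) ∈ c.source) :
    ∀ᶠ w in 𝓝 (c y), T.tubeChartInv c y (T.tubeChart c y w) = w := by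
  have h1 : Tendsto c.symm (𝓝 (c y)) (𝓝 (y : M)) := by
    simpa [hy] using (c.continuousAt_symm (c.map_source hy)).tendsto
  filter_upwards [h1.eventually (T.eventually_symm_mem_source y),
    h1.eventually (T.φ.open_target.mem_nhds (T.coe_mem_target y)),
    c.open_target.mem_nhds (c.map_source hy)] with w hw hw' hw''
  rw [tubeChartInv, tubeChart, PartialEquiv.left_inv _ hw, T.φ.right_inv hw', c.right_inv hw'']

variable (c y) in
theorem eventually_tubeChartInv_zero [VectorBundle ℝ F V] :
    ∀ᶠ a in 𝓝 (extChartAt (𝓡 r) y y),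
      T.tubeChartInv c y (a, 0) = c ((extChartAt (𝓡 r) y).symm a : R) := by
  filter_upwards [eventually_extChartAt_symm_mem_baseSet (F := F) (V := V) (r := r) y] with a ha
  have h0 : (trivializationAt F V y).symm ((extChartAt (𝓡 r) y).symm a) (0 : F) = 0 := by
    have := ((trivializationAt F V y).symmL ℝ ((extChartAt (𝓡 r) y).symm a)).map_zero
    rw [Trivialization.symmL_apply] at this
    · exact this
    · exact ha
  rw [tubeChartInv, extChartAt_totalSpace_symm_apply y ha, h0, T.map_zero]

theorem tendsto_coe_extChartAt_symm : Tendsto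
    (fun a => (((extChartAt (𝓡 r) y).symm a : R) : M)) (𝓝 (extChartAt (𝓡 r) y y)) (𝓝 (y : M)) := by
  have := (continuousAt_extChartAt_symm (I := 𝓡 r) y).tendsto
  rw [extChartAt_to_inv] at this
  exact (continuous_subtype_val.tendsto y).comp this

theorem eventually_tubeChart_tubeChartInv_zero [VectorBundle ℝ F V] (hy : (y : M) ∈ c.source) :
    ∀ᶠ a in 𝓝 (extChartAt (𝓡 r) y y),
      T.tubeChart c y (T.tubeChartInv c y (a, 0)) = (a, 0) := by
  filter_upwards [T.eventually_tubeChartInv_zero c y,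
    eventually_extChartAt_symm_mem_baseSet (F := F) (V := V) (r := r) y,
    tendsto_coe_extChartAt_symm.eventually (c.open_source.mem_nhds hy),
    extChartAt_target_mem_nhds (I := 𝓡 r) y] with a h1 h2 h3 h4
  rw [h1, T.tubeChart_coe h3 h2, PartialEquiv.right_inv _ h4]

section Smooth

variable [IsManifold (𝓡 m) ∞ M] [IsManifold (𝓡 r) ∞ R] [VectorBundle ℝ F V]
  [ContMDiffVectorBundle ∞ F V (𝓡 r)]

theorem contDiffAt_tubeChart (hc : c ∈ IsManifold.maximalAtlas (𝓡 m) ∞ M)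
    (hy : (y : M) ∈ c.source) : ContDiffAt ℝ ∞ (T.tubeChart c y) (c y) := by
  have h1 : ContMDiffAt (𝓡 m) (𝓡 m) ∞ c.symm (c y) :=
    (contMDiffOn_symm_of_mem_maximalAtlas hc).contMDiffAt
      (c.open_target.mem_nhds (c.map_source hy))
  have h2 : ContMDiffAt (𝓡 m) ((𝓡 r).prod 𝓘(ℝ, F)) ∞ T.φ.symm (c.symm (c y)) := by
    rw [c.left_inv hy]
    exact T.contMDiffOn_symm.contMDiffAt (T.φ.open_target.mem_nhds (T.coe_mem_target y))
  have h3 : ContMDiffAt ((𝓡 r).prod 𝓘(ℝ, F)) 𝓘(ℝ, EuclideanSpace ℝ (Fin r) × F) ∞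
      (extChartAt ((𝓡 r).prod 𝓘(ℝ, F)) (⟨y, 0⟩ : TotalSpace F V)) (T.φ.symm (c.symm (c y))) := by
    rw [c.left_inv hy, T.symm_coe]
    exact contMDiffAt_extChartAt
  exact (h3.comp (c y) (h2.comp (c y) h1)).contDiffAt

theorem contDiffAt_tubeChartInv (hc : c ∈ IsManifold.maximalAtlas (𝓡 m) ∞ M)
    (hy : (y : M) ∈ c.source) :
    ContDiffAt ℝ ∞ (T.tubeChartInv c y) (extChartAt (𝓡 r) y y, 0) := by
  have h0 := extChartAt_totalSpace_zero (r := r) (F := F) (V := V) y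
    (FiberBundle.mem_baseSet_trivializationAt' y)
  rw [← h0]
  set b := extChartAt ((𝓡 r).prod 𝓘(ℝ, F)) (⟨y, 0⟩ : TotalSpace F V) ⟨y, 0⟩
  have hb : (extChartAt ((𝓡 r).prod 𝓘(ℝ, F)) (⟨y, 0⟩ : TotalSpace F V)).symm b = ⟨y, 0⟩ :=
    extChartAt_to_inv _
  have h1 : ContMDiffAt 𝓘(ℝ, EuclideanSpace ℝ (Fin r) × F) ((𝓡 r).prod 𝓘(ℝ, F)) ∞
      (extChartAt ((𝓡 r).prod 𝓘(ℝ, F)) (⟨y, 0⟩ : TotalSpace F V)).symm b :=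
    (contMDiffOn_extChartAt_symm _).contMDiffAt (extChartAt_target_mem_nhds _)
  have h2 : ContMDiffAt ((𝓡 r).prod 𝓘(ℝ, F)) (𝓡 m) ∞ T.φ
      ((extChartAt ((𝓡 r).prod 𝓘(ℝ, F)) (⟨y, 0⟩ : TotalSpace F V)).symm b) := by
    rw [hb]
    exact T.contMDiffOn.contMDiffAt (T.φ.open_source.mem_nhds (T.zero_mem_source y))
  have h3 : ContMDiffAt (𝓡 m) (𝓡 m) ∞ c
      (T.φ ((extChartAt ((𝓡 r).prod 𝓘(ℝ, F)) (⟨y, 0⟩ : TotalSpace F V)).symm b)) := by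
    rw [hb, T.map_zero]
    exact (contMDiffOn_of_mem_maximalAtlas hc).contMDiffAt (c.open_source.mem_nhds hy)
  exact (h3.comp b (h2.comp b h1)).contDiffAt

theorem injective_fderiv_tubeChart (hc : c ∈ IsManifold.maximalAtlas (𝓡 m) ∞ M)
    (hy : (y : M) ∈ c.source) : Function.Injective (fderiv ℝ (T.tubeChart c y) (c y)) := by
  have h1 := ((T.contDiffAt_tubeChart hc hy).differentiableAt (by simp)).hasFDerivAt
  have h2 := ((T.contDiffAt_tubeChartInv hc hy).differentiableAt (by simp)).hasFDerivAt
  rw [← T.tubeChart_self hy] at h2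
  have h3 := (h2.comp (c y) h1).unique
    ((hasFDerivAt_id (c y)).congr_of_eventuallyEq (T.tubeChartInv_tubeChart hy))
  exact Function.LeftInverse.injective (g := fderiv ℝ (T.tubeChartInv c y) _)
    (DFunLike.congr_fun h3)

theorem fderiv_tubeChart_fderiv_tubeChartInv (hc : c ∈ IsManifold.maximalAtlas (𝓡 m) ∞ M)
    (hy : (y : M) ∈ c.source) (v : EuclideanSpace ℝ (Fin r)) :
    fderiv ℝ (T.tubeChart c y) (c y)
      (fderiv ℝ (T.tubeChartInv c y) (extChartAt (𝓡 r) y y, 0) (v, 0)) = (v, 0) := by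
  have h1 := ((T.contDiffAt_tubeChart hc hy).differentiableAt (by simp)).hasFDerivAt
  have h2 := ((T.contDiffAt_tubeChartInv hc hy).differentiableAt (by simp)).hasFDerivAt
  have e : T.tubeChartInv c y (extChartAt (𝓡 r) y y, 0) = c y := by
    rw [← T.tubeChart_self hy]
    exact (T.tubeChartInv_tubeChart hy).self_of_nhds
  have h4 : HasFDerivAt (fun a => (a, (0 : F))) (ContinuousLinearMap.inl ℝ _ F)
    (extChartAt (𝓡 r) y y) := hasFDerivAt_prodMk_left _ _
  rw [← e] at h1
  have h5 := HasFDerivAt.comp (g := T.tubeChart c y) (f := fun a => T.tubeChartInv c y (a, 0))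
    (extChartAt (𝓡 r) y y) h1
    (HasFDerivAt.comp (f := fun a => (a, (0 : F))) (extChartAt (𝓡 r) y y) h2 h4)
  have h6 := h5.unique (h4.congr_of_eventuallyEq (T.eventually_tubeChart_tubeChartInv_zero hy))
  rw [← e]
  simpa using DFunLike.congr_fun h6 v

end Smooth

end Charts

/-! ### From charts back to the manifold -/

section Transfer

variable (T : EquivariantTubularNeighborhood (m := m) (r := r) R F V)
  {c : OpenPartialHomeomorph M (EuclideanSpace ℝ (Fin m))} {y : R}
  [IsManifold (𝓡 m) ∞ M] [IsManifold (𝓡 r) ∞ R] [VectorBundle ℝ F V]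
  [ContMDiffVectorBundle ∞ F V (𝓡 r)] [IsContMDiffRiemannianBundle (𝓡 r) ∞ F V]

theorem eventually_proj_mem {x : M} (hx : x ∈ T.φ.target) {U : Set R} (hU : IsOpen U)
    (hxU : T.proj x ∈ U) : ∀ᶠ z in 𝓝 x, T.proj z ∈ U :=
  (T.contMDiffOn_proj.contMDiffAt (T.φ.open_target.mem_nhds hx)).continuousAt.eventually
    (hU.mem_nhds hxU)

/-- In charts the map is `(p₁, n ∘ p)` precomposed with `c ∘ i`. Uniqueness of derivatives
identifies the components, and the differential of the chart of `R` is invertible. -/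
theorem surjective_mfderiv_of_chart {s : ℕ} {S : Type*} [TopologicalSpace S]
    [ChartedSpace (EuclideanSpace ℝ (Fin s)) S] [IsManifold (𝓡 s) ∞ S] {i : S → M}
    (hi : ContMDiff (𝓡 s) (𝓡 m) ∞ i) (hc : c ∈ IsManifold.maximalAtlas (𝓡 m) ∞ M)
    {x : S} (hx : i x ∈ c.source) (hxt : i x ∈ T.φ.target)
    (hxK : T.φ.symm (i x) ∈
      (extChartAt ((𝓡 r).prod 𝓘(ℝ, F)) (⟨y, 0⟩ : TotalSpace F V)).source)
    (hxb : T.proj (i x) ∈ (trivializationAt F V y).baseSet)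
    (hxs : T.proj (i x) ∈ (extChartAt (𝓡 r) y).source)
    (hp : DifferentiableAt ℝ (T.tubeChart c y) (c (i x)))
    (hn : DifferentiableAt ℝ (chartNormSq F V y) (T.tubeChart c y (c (i x))))
    (hsurj : ∀ b : EuclideanSpace ℝ (Fin r) × ℝ, ∃ w ∈ tangentInChart (s := s) i c x,
      (fderiv ℝ (T.tubeChart c y) (c (i x)) w).1 = b.1 ∧
      fderiv ℝ (chartNormSq F V y) (T.tubeChart c y (c (i x)))
        (fderiv ℝ (T.tubeChart c y) (c (i x)) w) = b.2) :
    Function.Surjective (mfderiv (𝓡 s) ((𝓡 r).prod 𝓘(ℝ, ℝ)) (fun x => (T.proj (i x), T.rho (i x)))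
      x) := by
  have hnt := T.φ.open_target.mem_nhds hxt
  have hproj : MDifferentiableAt (𝓡 s) (𝓡 r) (fun x => T.proj (i x)) x :=
    ((T.contMDiffOn_proj.contMDiffAt hnt).comp x hi.contMDiffAt).mdifferentiableAt (by simp)
  have hrho : MDifferentiableAt (𝓡 s) 𝓘(ℝ, ℝ) (fun x => T.rho (i x)) x :=
    ((T.contMDiffOn_rho.contMDiffAt hnt).comp x hi.contMDiffAt).mdifferentiableAt (by simp)
  have hj : HasMFDerivAt (𝓡 s) (𝓡 m) (fun x => c (i x)) x
      (mfderiv (𝓡 s) (𝓡 m) (fun x => c (i x)) x) :=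
    ((((contMDiffOn_of_mem_maximalAtlas hc).contMDiffAt (c.open_source.mem_nhds hx)).comp x
      hi.contMDiffAt).mdifferentiableAt (by simp)).hasMFDerivAt
  have hpj := hp.hasFDerivAt.hasMFDerivAt.comp x hj
  have hix : Tendsto i (𝓝 x) (𝓝 (i x)) := hi.continuous.tendsto x
  have e1 : (fun x => extChartAt (𝓡 r) y (T.proj (i x))) =ᶠ[𝓝 x]
      fun x => (T.tubeChart c y (c (i x))).1 := by
    filter_upwards [hix.eventually (c.open_source.mem_nhds hx), hix.eventually
      (T.eventually_proj_mem hxt (trivializationAt F V y).open_baseSet hxb)] with z hz hz'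
    rw [T.tubeChart_fst hz hz']
  have e2 : (fun x => T.rho (i x)) =ᶠ[𝓝 x]
      fun x => chartNormSq F V y (T.tubeChart c y (c (i x))) := by
    filter_upwards [hix.eventually (c.open_source.mem_nhds hx), hix.eventually
      ((T.φ.continuousAt_symm hxt).eventually ((isOpen_extChartAt_source _).mem_nhds hxK))]
      with z hz hz'
    rw [T.chartNormSq_tubeChart hz hz']
  have hψ : MDifferentiableAt (𝓡 r) 𝓘(ℝ, EuclideanSpace ℝ (Fin r)) (extChartAt (𝓡 r) y)
      (T.proj (i x)) := mdifferentiableAt_extChartAt (by simpa using hxs)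
  have d1 := (HasMFDerivAt.comp x hψ.hasMFDerivAt hproj.hasMFDerivAt)
  have d1' := ((ContinuousLinearMap.fst ℝ (EuclideanSpace ℝ (Fin r)) F).hasFDerivAt
    (x := T.tubeChart c y (c (i x)))).hasMFDerivAt.comp x hpj
  have d2' := hn.hasFDerivAt.hasMFDerivAt.comp x hpj
  have u1 := hasMFDerivAt_unique d1 (d1'.congr_of_eventuallyEq e1)
  have u2 := hasMFDerivAt_unique hrho.hasMFDerivAt (d2'.congr_of_eventuallyEq e2)
  rw [mfderiv_prodMk hproj hrho]
  rintro ⟨b₁, b₂⟩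
  obtain ⟨_, ⟨w, rfl⟩, h1, h2⟩ := hsurj (mfderiv (𝓡 r) 𝓘(ℝ, EuclideanSpace ℝ (Fin r))
    (extChartAt (𝓡 r) y) (T.proj (i x)) b₁, b₂)
  refine ⟨w, Prod.ext ?_ ?_⟩
  · have hinv := (isInvertible_mfderiv_extChartAt (I := 𝓡 r) hxs).injective
    exact hinv ((DFunLike.congr_fun u1 w).trans h1)
  · exact (DFunLike.congr_fun u2 w).trans h2

end Transfer

/-! ### Consequences of Whitney's condition (B) -/

section Whitney

variable (T : EquivariantTubularNeighborhood (m := m) (r := r) R F V)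
  {c : OpenPartialHomeomorph M (EuclideanSpace ℝ (Fin m))} {y : R}
  [IsManifold (𝓡 m) ∞ M] [IsManifold (𝓡 r) ∞ R] [VectorBundle ℝ F V]
  [ContMDiffVectorBundle ∞ F V (𝓡 r)] [IsContMDiffRiemannianBundle (𝓡 r) ∞ F V]

/-- Condition (B) implies condition (A): limits of tangent spaces of the larger stratum contain the
tangent space of the smaller one. -/
theorem fderiv_tubeChartInv_mem_of_whitney {s : ℕ} {S : Type*} [TopologicalSpace S]
    [ChartedSpace (EuclideanSpace ℝ (Fin s)) S] {i : S → M}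
    (hc : c ∈ IsManifold.maximalAtlas (𝓡 m) ∞ M) (hy : (y : M) ∈ c.source)
    (hB : ∀ (x : ℕ → S) (z : ℕ → M) (τ ℓ : Submodule ℝ (EuclideanSpace ℝ (Fin m))),
      (∀ k, i (x k) ∈ c.source) → (∀ k, z k ∈ (R : Set M) ∩ c.source) →
      Tendsto (fun k => i (x k)) atTop (𝓝 (y : M)) → Tendsto z atTop (𝓝 (y : M)) →
      SubspaceTendsto (fun k => tangentInChart (s := s) i c (x k)) τ →
      SubspaceTendsto (fun k => Submodule.span ℝ {c (i (x k)) - c (z k)}) ℓ → ℓ ≤ τ)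
    {x : ℕ → S} {τ : Submodule ℝ (EuclideanSpace ℝ (Fin m))}
    (hx : Tendsto (fun k => i (x k)) atTop (𝓝 (y : M)))
    (hτ : SubspaceTendsto (fun k => tangentInChart (s := s) i c (x k)) τ)
    (v : EuclideanSpace ℝ (Fin r)) :
    fderiv ℝ (T.tubeChartInv c y) (extChartAt (𝓡 r) y y, 0) (v, 0) ∈ τ := by
  set a₀ := extChartAt (𝓡 r) y y
  set w := fderiv ℝ (T.tubeChartInv c y) (a₀, 0) (v, 0)
  by_cases hw : w = 0
  · rw [hw]
    exact τ.zero_mem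
  have hcx : Tendsto (fun k => c (i (x k))) atTop (𝓝 (c y)) :=
    (c.continuousAt hy).tendsto.comp hx
  set δ : ℕ → ℝ := fun k => ‖c (i (x k)) - c y‖
  have hδ : Tendsto δ atTop (𝓝 0) := tendsto_iff_norm_sub_tendsto_zero.1 hcx
  have hδ' : Tendsto (fun k => √(δ k)) atTop (𝓝 0) := by
    simpa using hδ.sqrt
  -- the secants from `x k` to points of `R` at distance of order `t k ≫ δ k` from `y`
  set t : ℕ → ℝ := fun k => √(δ k) + 1 / ((k : ℝ) + 1)
  have ht : Tendsto t atTop (𝓝 0) := by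
    rw [← add_zero (0 : ℝ)]
    exact hδ'.add tendsto_one_div_add_atTop_nhds_zero_nat
  have htpos (k : ℕ) : 0 < t k := by positivity
  have ha : Tendsto (fun k => a₀ + t k • v) atTop (𝓝 a₀) := by
    simpa using (tendsto_const_nhds (x := a₀)).add (ht.smul_const v)
  have e0 : T.tubeChartInv c y (a₀, 0) = c y := by
    rw [← T.tubeChart_self hy]
    exact (T.tubeChartInv_tubeChart hy).self_of_nhds
  -- Since `δ k = √(δ k) * √(δ k) ≤ t k * √(δ k)`, the displacement of `x k` from `y` is negligible
  -- at scale `t k`, and the secants take the direction `-w`. The summand `1 / (k + 1)` keeps `t k`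
  -- positive even when `δ k = 0`.
  have h1 : Tendsto (fun k => (t k)⁻¹ • (c (i (x k)) - c y)) atTop (𝓝 0) := by
    refine squeeze_zero_norm (fun k => ?_) hδ'
    rw [norm_smul, norm_inv, Real.norm_of_nonneg (htpos k).le, inv_mul_le_iff₀ (htpos k)]
    have hd : 0 ≤ δ k := norm_nonneg _
    calc δ k = √(δ k) * √(δ k) := (Real.mul_self_sqrt hd).symm
      _ ≤ t k * √(δ k) := by
        gcongr
        exact le_add_of_nonneg_right (by positivity)
  have h2 : Tendsto (fun k => (t k)⁻¹ • (T.tubeChartInv c y (a₀ + t k • v, 0)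
      - T.tubeChartInv c y (a₀, 0))) atTop (𝓝 w) := by
    refine HasStrictFDerivAt.tendsto_smul_sub
      ((T.contDiffAt_tubeChartInv hc hy).hasStrictFDerivAt (by simp))
      (x := fun k => (a₀ + t k • v, 0)) (z := fun _ => (a₀, 0)) (ha.prodMk_nhds tendsto_const_nhds)
      tendsto_const_nhds (tendsto_const_nhds.congr fun k => ?_)
    simp [smul_smul, inv_mul_cancel₀ (htpos k).ne']
  have h3 : Tendsto (fun k => (t k)⁻¹ • (c (i (x k))
      - c ((extChartAt (𝓡 r) y).symm (a₀ + t k • v) : R))) atTop (𝓝 (-w)) := by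
    have := h1.sub h2
    rw [zero_sub] at this
    refine this.congr' ?_
    filter_upwards [ha.eventually (T.eventually_tubeChartInv_zero c y)] with k hk
    rw [← smul_sub, e0, hk]
    congr 1
    abel
  have h4 := le_of_whitney_of_eventually hB hy
    (z := fun k => ((extChartAt (𝓡 r) y).symm (a₀ + t k • v) : R)) (fun k => Subtype.coe_prop _) hx
    (tendsto_coe_extChartAt_symm.comp ha) hτ
    (subspaceTendsto_span_singleton (neg_ne_zero.2 hw)
      (Eventually.of_forall fun k => inv_ne_zero (htpos k).ne') h3)
  exact neg_mem_iff.1 (h4 (Submodule.mem_span_singleton_self _))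

/-- Near every point of `R`, the map `(π_T, ϱ_T)` is a submersion along the larger stratum. -/
theorem eventually_surjective_mfderiv {s : ℕ} {S : Type*} [TopologicalSpace S]
    [ChartedSpace (EuclideanSpace ℝ (Fin s)) S] [IsManifold (𝓡 s) ∞ S] {i : S → M}
    [SecondCountableTopology M]
    (hi : ContMDiff (𝓡 s) (𝓡 m) ∞ i) (hRS : ∀ x, i x ∉ R)
    (hB : WhitneyConditionB (m := m) (s := s) i (R : Set M)) (y : R) :
    ∀ᶠ x in comap i (𝓝 (y : M)), Function.Surjective
      (mfderiv (𝓡 s) ((𝓡 r).prod 𝓘(ℝ, ℝ)) (fun x => (T.proj (i x), T.rho (i x))) x) := by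
  obtain ⟨c, hc, hy, hB⟩ := hB y y.2
  by_contra hcon
  obtain ⟨x₀, hx₀, hbad₀⟩ := exists_seq_forall_of_frequently (not_eventually.1 hcon)
  rw [tendsto_comap_iff] at hx₀
  have hprojy : T.proj (y : M) = y := T.proj_coe y
  have hcproj : ContinuousAt T.proj (y : M) :=
    (T.contMDiffOn_proj.contMDiffAt (T.φ.open_target.mem_nhds (T.coe_mem_target y))).continuousAt
  have hprojt : Tendsto T.proj (𝓝 (y : M)) (𝓝 y) := by
    simpa only [ContinuousAt, hprojy] using hcproj
  obtain ⟨τ, ψ₁, hψ₁, hτ₀⟩ := exists_subseq_subspaceTendsto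
    (fun k => tangentInChart (s := s) i c (x₀ k))
  -- Secants to the foot points `π_T (x k)`: these are the ones that become vertical in the tube
  -- chart.
  set h₀ : ℕ → EuclideanSpace ℝ (Fin m) :=
    fun k => c (i (x₀ (ψ₁ k))) - c (T.proj (i (x₀ (ψ₁ k))) : R)
  obtain ⟨u, -, ψ₂, hψ₂, hu⟩ := (isCompact_closedBall (0 : EuclideanSpace ℝ (Fin m)) 1).tendsto_subseq
    (x := fun k => ‖h₀ k‖⁻¹ • h₀ k) (fun k => by
      rw [mem_closedBall_zero_iff, norm_smul, norm_inv, norm_norm]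
      exact inv_mul_le_one)
  set x : ℕ → S := fun k => x₀ (ψ₁ (ψ₂ k))
  have hx : Tendsto (fun k => i (x k)) atTop (𝓝 (y : M)) :=
    hx₀.comp (hψ₁.tendsto_atTop.comp hψ₂.tendsto_atTop)
  have hτ : SubspaceTendsto (fun k => tangentInChart (s := s) i c (x k)) τ :=
    hτ₀.comp hψ₂.tendsto_atTop
  have hbad (k : ℕ) : ¬ Function.Surjective
      (mfderiv (𝓡 s) ((𝓡 r).prod 𝓘(ℝ, ℝ)) (fun x => (T.proj (i x), T.rho (i x))) (x k)) :=
    hbad₀ _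
  set z : ℕ → R := fun k => T.proj (i (x k))
  have hz : Tendsto z atTop (𝓝 y) := hprojt.comp hx
  have hz' : Tendsto (fun k => (z k : M)) atTop (𝓝 (y : M)) :=
    (continuous_subtype_val.tendsto y).comp hz
  replace hu : Tendsto (fun k => ‖c (i (x k)) - c (z k)‖⁻¹ • (c (i (x k)) - c (z k))) atTop (𝓝 u) :=
    hu
  have hcs := c.open_source.mem_nhds hy
  -- Equality would put a point of `S` in `R`; hence the normalised secants are eventually unit
  -- vectors and `u ≠ 0`.
  have hne : ∀ᶠ k in atTop, c (i (x k)) ≠ c (z k) := by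
    filter_upwards [hx.eventually hcs, hz'.eventually hcs] with k h1 h2 heq
    exact hRS (x k) (c.injOn h1 h2 heq ▸ (z k).2)
  have hu1 : ‖u‖ = 1 := by
    refine tendsto_nhds_unique hu.norm (tendsto_const_nhds.congr' ?_)
    filter_upwards [hne] with k hk
    rw [norm_smul, norm_inv, norm_norm,
      inv_mul_cancel₀ (norm_ne_zero_iff.2 (sub_ne_zero.2 hk))]
  have hu0 : u ≠ 0 := by
    rintro rfl
    simp at hu1
  have huτ : u ∈ τ := le_of_whitney_of_eventually hB hy (fun k => (z k).2) hx hz' hτ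
    (subspaceTendsto_span_singleton hu0 (hne.mono fun k hk =>
      inv_ne_zero (norm_ne_zero_iff.2 (sub_ne_zero.2 hk))) hu) (Submodule.mem_span_singleton_self u)
  have hbase := (trivializationAt F V y).open_baseSet.mem_nhds
    (FiberBundle.mem_baseSet_trivializationAt' y)
  have hcx : Tendsto (fun k => c (i (x k))) atTop (𝓝 (c y)) := (c.continuousAt hy).tendsto.comp hx
  have hp := T.contDiffAt_tubeChart hc hy
  have hn := contDiffAt_chartNormSq (r := r) (F := F) (V := V) y
  have hev := eventually_surjective_of_subspaceTendsto (hp.of_le ENat.LEInfty.out)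
    (T.tubeChart_self hy)
    (T.injective_fderiv_tubeChart hc hy) (hn.of_le ENat.LEInfty.out)
    (eventually_chartNormSq_smul y)
    (Eventually.of_forall fun a f => chartNormSq_nonneg y (a, f)) (fun f hf => chartNormSq_pos y hf)
    hcx ((c.continuousAt hy).tendsto.comp hz') hne
    (by
      filter_upwards [hx.eventually hcs, hz'.eventually hcs, hz.eventually hbase] with k h1 h2 h3
      simp only [Function.comp_apply]
      rw [T.tubeChart_coe h2 h3, T.tubeChart_fst h1 h3])
    hu hu0 hτ huτ
    (fun v => ⟨_, T.fderiv_tubeChartInv_mem_of_whitney hc hy hB hx hτ v,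
      T.fderiv_tubeChart_fderiv_tubeChartInv hc hy v⟩)
  have hpd : ∀ᶠ k in atTop, DifferentiableAt ℝ (T.tubeChart c y) (c (i (x k))) :=
    hcx.eventually (((hp.of_le (m := 1) ENat.LEInfty.out).eventually (by simp)).mono
      fun w hw => hw.differentiableAt (by simp))
  have hnd : ∀ᶠ k in atTop, DifferentiableAt ℝ (chartNormSq F V y)
      (T.tubeChart c y (c (i (x k)))) := by
    have h1 := hp.continuousAt.tendsto.comp hcx
    rw [T.tubeChart_self hy] at h1
    exact h1.eventually (((hn.of_le (m := 1) ENat.LEInfty.out).eventually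
      (by simp)).mono fun w hw => hw.differentiableAt (by simp))
  obtain ⟨k, h1, h2, h3, h4, h5, h6, h7, h8⟩ := (hev.and <| (hx.eventually hcs).and <|
    (hx.eventually (T.φ.open_target.mem_nhds (T.coe_mem_target y))).and <|
    (hx.eventually (T.eventually_symm_mem_source y)).and <| (hz.eventually hbase).and <|
    (hz.eventually (extChartAt_source_mem_nhds (I := 𝓡 r) y)).and <| hpd.and hnd).exists
  exact hbad k (T.surjective_mfderiv_of_chart hi hc h2 h3 h4 h5 h6 h7 h8 h1)

end Whitney

/-! ### Smooth radius functions -/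

section Radius

/-- A map into `R` is smooth if it is smooth as a map into `M`: the tube projection is a smooth
retraction onto `R`. -/
theorem contMDiff_of_coe_comp [IsManifold (𝓡 r) ∞ R] [VectorBundle ℝ F V]
    [ContMDiffVectorBundle ∞ F V (𝓡 r)]
    (T : EquivariantTubularNeighborhood (m := m) (r := r) R F V)
    {E H N : Type*} [NormedAddCommGroup E] [NormedSpace ℝ E]
    [TopologicalSpace H] {I : ModelWithCorners ℝ E H} [TopologicalSpace N] [ChartedSpace H N]
    {f : N → R} (hf : ContMDiff I (𝓡 m) ∞ fun x => (f x : M)) : ContMDiff I (𝓡 r) ∞ f := by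
  intro x
  have := (T.contMDiffOn_proj.contMDiffAt
    (T.φ.open_target.mem_nhds (T.coe_mem_target (f x)))).comp x (hf x)
  simpa only [Function.comp_def, T.proj_coe] using this

/-- A neighbourhood of `R` in `M` contains a tube of smoothly varying radius. -/
theorem exists_contMDiff_radius [T2Space M] [SecondCountableTopology M] [IsManifold (𝓡 r) ∞ R]
    [VectorBundle ℝ F V] [IsContMDiffRiemannianBundle (𝓡 r) ∞ F V]
    (T : EquivariantTubularNeighborhood (m := m) (r := r) R F V) {W : Set M} (hW : IsOpen W)
    (hRW : ∀ x : R, (x : M) ∈ W) :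
    ∃ f : R → ℝ, ContMDiff (𝓡 r) 𝓘(ℝ, ℝ) ∞ f ∧ (∀ x, 0 < f x) ∧
      ∀ v ∈ T.φ.source, fiberNormSq v < f v.proj → T.φ v ∈ W := by
  have : IsContinuousRiemannianBundle F V :=
    IsContMDiffRiemannianBundle.isContinuousRiemannianBundle (r := r)
  have : LocallyCompactSpace R := ChartedSpace.locallyCompactSpace (EuclideanSpace ℝ (Fin r)) R
  have : SecondCountableTopology R := TopologicalSpace.Subtype.secondCountableTopology _
  have : T2Space R := instT2SpaceSubtype
  -- The admissible radii at a point form an interval, and a small constant is admissible near each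
  -- point, so a smooth partition of unity glues them.
  obtain ⟨f, hf⟩ := exists_contMDiffMap_forall_mem_convex_of_local_const (n := ⊤) (𝓡 r)
    (t := fun x : R => {δ : ℝ | 0 < δ ∧ ∀ v : TotalSpace F V, v.proj = x → fiberNormSq v < δ →
      v ∈ T.φ.source → T.φ v ∈ W})
    (fun x => Set.OrdConnected.convex ⟨fun a ha b hb δ hδ => ⟨ha.1.trans_le hδ.1,
      fun v h1 h2 h3 => hb.2 v h1 (h2.trans_le hδ.2) h3⟩⟩)
    (fun x => by
      have hO : T.φ.source ∩ T.φ ⁻¹' W ∈ 𝓝 (⟨x, 0⟩ : TotalSpace F V) :=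
        (T.φ.isOpen_inter_preimage hW).mem_nhds ⟨T.zero_mem_source x, by
          rw [mem_preimage, T.map_zero]
          exact hRW x⟩
      obtain ⟨δ, hδ, h⟩ := exists_fiberNormSq_lt_subset x hO
      exact ⟨δ, h.mono fun y hy => ⟨hδ, fun v h1 h2 _ => (hy v h1 h2).2⟩⟩)
  exact ⟨f, f.contMDiff, fun x => (hf x).1, fun v hv hlt => (hf v.proj).2 v rfl hlt hv⟩

end Radius

end EquivariantTubularNeighborhood

/-! ### Proof of the theorem -/

theorem mainTheorem6 {d m r s : ℕ}
    -- a compact Lie group `G`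
    {G : Type*} [TopologicalSpace G] [ChartedSpace (EuclideanSpace ℝ (Fin d)) G] [Group G]
    [LieGroup (𝓡 d) ∞ G] [CompactSpace G]
    -- a smooth `G`-manifold `M`
    {M : Type*} [TopologicalSpace M] [T2Space M] [SecondCountableTopology M]
    [ChartedSpace (EuclideanSpace ℝ (Fin m)) M] [IsManifold (𝓡 m) ∞ M]
    [MulAction G M] [ContMDiffSMul (𝓡 d) (𝓡 m) ∞ G M]
    -- disjoint `G`-invariant submanifolds `R` and `S` of `M`
    (R S : SubMulAction G M)
    [ChartedSpace (EuclideanSpace ℝ (Fin r)) R] [IsManifold (𝓡 r) ∞ R]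
    (hR : IsSmoothEmbedding (𝓡 r) (𝓡 m) ∞ (Subtype.val : R → M))
    [ChartedSpace (EuclideanSpace ℝ (Fin s)) S] [IsManifold (𝓡 s) ∞ S]
    (hS : IsSmoothEmbedding (𝓡 s) (𝓡 m) ∞ (Subtype.val : S → M))
    (hRS : Disjoint (R : Set M) (S : Set M))
    (hB : WhitneyConditionB (m := m) (s := s) (Subtype.val : S → M) (R : Set M))
    -- a `G`-vector bundle `V` over `R` with an invariant inner product
    {F : Type*} [NormedAddCommGroup F] [NormedSpace ℝ F] [FiniteDimensional ℝ F]
    {V : R → Type*} [∀ x, NormedAddCommGroup (V x)] [∀ x, InnerProductSpace ℝ (V x)]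
    [TopologicalSpace (TotalSpace F V)] [FiberBundle F V] [VectorBundle ℝ F V]
    [ContMDiffVectorBundle ∞ F V (𝓡 r)] [IsContMDiffRiemannianBundle (𝓡 r) ∞ F V]
    [MulAction G (TotalSpace F V)] (hV : IsEquivariantRiemannianBundle d r G R F V)
    -- a `G`-equivariant tubular neighbourhood of `R` in `M` with bundle `V`
    (T : EquivariantTubularNeighborhood (m := m) (r := r) R F V) :
    ∃ ε' : R → ℝ,
      (∀ x, 0 < ε' x) ∧ ContMDiff (𝓡 r) 𝓘(ℝ, ℝ) ∞ ε' ∧ (∀ (g : G) (x : R), ε' (g • x) = ε' x) ∧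
      (∀ x : S, (x : M) ∈ T.shrink ε' → 0 < T.rho x) ∧
      IsSmoothSubmersionOn (𝓡 s) ((𝓡 r).prod 𝓘(ℝ, ℝ))
        (fun x : S => (T.proj x, T.rho x)) {x : S | (x : M) ∈ T.shrink ε'} := by
  have hi := hS.contMDiff
  -- an open neighbourhood of `R` on which `(π_T, ϱ_T)` is submersive along `S`
  set Ω : Set M := interior {b : M | ∀ a : S, (a : M) = b → Function.Surjective
    (mfderiv (𝓡 s) ((𝓡 r).prod 𝓘(ℝ, ℝ)) (fun x : S => (T.proj x, T.rho x)) a)}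
  have hΩR (y : R) : (y : M) ∈ Ω := mem_interior_iff_mem_nhds.2 (eventually_comap.1
    (T.eventually_surjective_mfderiv hi (fun x hx => disjoint_left.1 hRS hx x.2) hB y))
  have hsmulM : ContMDiff ((𝓡 d).prod (𝓡 m)) (𝓡 m) ∞ fun p : G × M => p.1 • p.2 :=
    ContMDiffSMul.contMDiff_smul
  -- The radius is fitted to the set of points whose whole orbit lies in `Ω`, which contains `R`
  -- because `R` is invariant.
  obtain ⟨f, hf, hfpos, hfW⟩ := T.exists_contMDiff_radius
    (isOpen_setOf_forall_smul_mem hsmulM.continuous (isOpen_interior : IsOpen Ω))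
    (fun x g => hΩR (g • x))
  have hsmulR : ContMDiff ((𝓡 r).prod (𝓡 d)) (𝓡 r) ∞ fun p : R × G => p.2⁻¹ • p.1 := by
    refine T.contMDiff_of_coe_comp ?_
    exact hsmulM.comp ((((contMDiff_inv (𝓡 d) ∞).comp contMDiff_snd)).prodMk
      (hR.contMDiff.comp contMDiff_fst))
  obtain ⟨ε', hε', hpos, hinv, hle⟩ := exists_invariant_average hsmulR hf hfpos
  have hNcont : Continuous (fiberNormSq : TotalSpace F V → ℝ) :=
    (contMDiff_fiberNormSq (r := r)).continuous
  have hopenM : IsOpen (T.shrink ε') := by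
    have h1 : bundleBall T.ε ∩ bundleBall ε' ⊆ T.φ.source := by
      rw [T.source_eq]
      exact inter_subset_left
    refine T.φ.isOpen_image_of_subset_source (IsOpen.inter ?_ ?_) h1
    · rw [← T.source_eq]
      exact T.φ.open_source
    · exact isOpen_lt hNcont (hε'.continuous.comp (FiberBundle.continuous_proj F V))
  have hsub : T.shrink ε' ⊆ T.φ.target := by
    rintro _ ⟨v, hv, rfl⟩
    exact T.φ.map_source (T.source_eq ▸ hv.1)
  have hmaps : MapsTo (Subtype.val : S → M) {x : S | (x : M) ∈ T.shrink ε'} T.φ.target :=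
    fun x hx => hsub hx
  refine ⟨ε', hpos, hε', hinv, ?_, hopenM.preimage continuous_subtype_val,
    (T.contMDiffOn_proj.comp hi.contMDiffOn hmaps).prodMk
      (T.contMDiffOn_rho.comp hi.contMDiffOn hmaps), ?_⟩
  -- If `ϱ_T` vanished at `x`, then `x` would be the image of a zero vector and hence a point of
  -- `R`.
  · intro x hx
    refine real_inner_self_pos.2 fun h0 => disjoint_left.1 hRS ?_ x.2
    have hv : T.φ.symm (x : M) = ⟨T.proj x, 0⟩ :=
      congrArg (fun w : V (T.proj x) => (⟨T.proj x, w⟩ : TotalSpace F V)) h0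
    have hxv : (x : M) = T.proj x := by
      rw [← T.map_zero, ← hv, T.φ.right_inv (hsub hx)]
    rw [hxv]
    exact (T.proj x).2
  · intro x hx
    obtain ⟨⟨b, w⟩, ⟨hvε, hvε'⟩, hvx⟩ := hx
    -- The average `ε' b` need not be at most `f b`, only at most `f (g⁻¹ • b)` for some `g`. So the
    -- vector is moved by `g⁻¹` into the tube of radius `f`; its image there has its whole orbit in
    -- `Ω`, and acting by `g` returns to `x`.
    obtain ⟨g, hg⟩ := hle b
    obtain ⟨L, hL⟩ := hV.smul_fiber g⁻¹ b
    have hvs : (⟨b, w⟩ : TotalSpace F V) ∈ T.φ.source := T.source_eq ▸ hvε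
    have hNL : inner ℝ (L w) (L w) = inner ℝ w w := L.inner_map_map w w
    have hgs : (⟨g⁻¹ • b, L w⟩ : TotalSpace F V) ∈ T.φ.source := by
      rw [T.source_eq]
      change inner ℝ (L w) (L w) < T.ε (g⁻¹ • b)
      rw [hNL, T.ε_smul]
      exact hvε
    have hlt : fiberNormSq (⟨g⁻¹ • b, L w⟩ : TotalSpace F V) < f (g⁻¹ • b) := by
      change inner ℝ (L w) (L w) < f (g⁻¹ • b)
      rw [hNL]
      exact lt_of_lt_of_le hvε' hg
    have hmem := hfW _ hgs hlt g
    rw [← hL w, T.map_smul g⁻¹ _ hvs, smul_inv_smul, hvx] at hmem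
    exact interior_subset hmem x rfl
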